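/- Let $\mathbb{D}=\{z\in\mathbb{C}:|z|<1\}$ and $\alpha\in[1,2]$. Let $Co(\alpha)$ be the class of concave univalent functions: those analytic $f:\mathbb{D}\to\mathbb{C}$ with $f(0)=0$, $f'(0)=1$ and $f(z)\to\infty$ as $z\to1$ in $\mathbb{D}$ (that is, $f(1)=\infty$), which map $\mathbb{D}$ conformally (injectively) onto a domain $f(\mathbb{D})$ whose complement $\mathbb{C}\setminus f(\mathbb{D})$ is convex and whose opening angle at $\infty$ is at most $\pi\alpha$. Here the opening angle of $\Omega\subset\mathbb{C}$ at $\infty$ is the Lebesgue measure of the set of $\theta\in(-\pi,\pi]$ such that $te^{i\theta}\in\Omega$ for all sufficiently large $t>0$. For locally univalent $f$ put $$T_f=\frac{f''}{f'},\qquad \|T_f\|=\sup_{z\in\mathbb{D}}(1-|z|^2)\,|T_f(z)|\in[0,\infty].$$ Then every $f\in Co(\alpha)$ satisfies $$4\le\|T_f\|\le 2\alpha+2.$$ Both bounds are attained in $Co(\alpha)$: the functions $$g_\pi(z)=\frac{z}{1-z},\qquad g_0(z)=\frac{1}{2\alpha}\left[\left(\frac{1+z}{1-z}\right)^{\alpha}-1\right]$$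 (principal branch of the power) belong to $Co(\alpha)$, with $\|T_{g_\pi}\|=4$ and $\|T_{g_0}\|=2\alpha+2$. -/

import Mathlib

open Set Filter Topology MeasureTheory
open scoped ENNReal

/-- The pre-Schwarzian derivative `T_f = f'' / f'`. -/
noncomputable def preSchwarzian (f : ℂ → ℂ) (z : ℂ) : ℂ :=
  deriv (deriv f) z / deriv f z

/-- The norm `‖T_f‖ = sup_{|z| < 1} (1 - |z|²) |T_f(z)|`, as an element of `[0, ∞]`. -/
noncomputable def preSchwarzianNorm (f : ℂ → ℂ) : ℝ≥0∞ :=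
  ⨆ z ∈ Metric.ball (0 : ℂ) 1, ENNReal.ofReal ((1 - ‖z‖ ^ 2) * ‖preSchwarzian f z‖)

/-- The opening angle of `Ω ⊆ ℂ` at infinity: the angular measure of the set of directions
`e^{iθ}` in which the ray `{t e^{iθ} : t > 0}` eventually stays in `Ω`.
When the complement of `Ω` is a closed convex set, every ray eventually stays in `Ω` or
eventually stays in the complement, so that this is `2π` minus the angle of the cone of
directions in which the complement is unbounded. -/
noncomputable def openingAngleAtInfinity (Ω : Set ℂ) : ℝ≥0∞ :=
  volume {θ : ℝ | θ ∈ Ioc (-Real.pi) Real.pi ∧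
    ∀ᶠ t : ℝ in atTop, (t : ℂ) * Complex.exp (θ * Complex.I) ∈ Ω}

/-- The class `Co(α)` of concave univalent functions in the unit disk. Only the values of
the function on the open unit disk matter. -/
structure IsConcaveUnivalent (α : ℝ) (f : ℂ → ℂ) : Prop where
  /-- `f` is analytic in the unit disk -/
  analytic : DifferentiableOn ℂ f (Metric.ball 0 1)
  map_zero : f 0 = 0
  deriv_zero : deriv f 0 = 1
  /-- `f(1) = ∞` -/
  tendsto_infinity : Tendsto f (𝓝[Metric.ball 0 1] 1) (Bornology.cobounded ℂ)
  /-- `f` maps the disk conformally onto its image -/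
  univalent : InjOn f (Metric.ball 0 1)
  /-- the complement of the image is convex -/
  convex_compl : Convex ℝ (f '' Metric.ball 0 1)ᶜ
  /-- the opening angle of the image at infinity is at most `πα` -/
  openingAngle_le : openingAngleAtInfinity (f '' Metric.ball 0 1) ≤ ENNReal.ofReal (Real.pi * α)

/-- The function `g_π(z) = z / (1 - z)`. -/
noncomputable def gPi (z : ℂ) : ℂ := z / (1 - z)

/-- The function `g_0(z) = (1 / (2α)) [((1 + z) / (1 - z))^α - 1]`, principal branch. -/
noncomputable def gZero (α : ℝ) (z : ℂ) : ℂ :=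
  1 / (2 * (α : ℂ)) * (((1 + z) / (1 - z)) ^ (α : ℂ) - 1)

/-! Upper bound. Let Ω = f(𝔻) and let K be its complement, a closed convex set. Since f(1) = ∞, K is
unbounded (`not_isBounded_compl_image`), so it has recession directions c, and w ↦ w - tc maps Ω
into itself for t ≥ 0. Pulled back by f, these translations are self-maps of the disk. Following
points of Ω that recede from K and applying Schwarz-Pick gives, as in Julia's lemma, a boundary
point τ whose horodisks all these self-maps preserve (`horodisk_invariant`). Differentiating at t =
0 yields Re(conj c · D(z)) ≥ 0 for D(z) = -conj τ (τ - z)² f'(z), for every recession direction c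
with the same τ (`exists_re_conj_mul_nonneg`).

An opening angle of at most πα forces the recession cone to have angle at least 2π - πα, so D takes
values in a sector of opening π(α - 1) (`exists_sector`). A root of D then has nonnegative real part
after a rotation, and Schwarz-Pick gives (1 - |z|²)|D'/D| ≤ 2(α - 1). As T_f = D'/D + 2/(τ - z), the
remaining term contributes at most 4.

Lower bound. If ‖T_f‖ < 4, integrating f''/f' and then f' gives f(z) = O((1 - |z|)^(1-p)) for some p
< 2. But Ω contains a half-plane around 0, so a half-plane map is subordinate to f, and Schwarz's
lemma forces growth of order 1/(1 - r): a contradiction.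

Sharpness. The image of `gPi` is a half-plane, that of `gZero` a sector of opening πα; the value 2α
+ 2 is approached along the radius to 1. -/

/-! ### Disk automorphisms and Schwarz-Pick estimates -/

section DiskAutomorphism

open Metric ComplexConjugate

/-- The automorphism `z ↦ (z - a) / (1 - conj a * z)` of the unit disk, sending `a` to `0`. -/
noncomputable def diskAut (a z : ℂ) : ℂ := (z - a) / (1 - conj a * z)

lemma one_sub_conj_mul_ne_zero {a z : ℂ} (ha : ‖a‖ ≤ 1) (hz : ‖z‖ < 1) : 1 - conj a * z ≠ 0 := by
  intro h
  have h1 : ‖conj a * z‖ = 1 := by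
    rw [← sub_eq_zero.1 h, norm_one]
  rw [norm_mul, RCLike.norm_conj] at h1
  nlinarith [norm_nonneg a, norm_nonneg z]

/-- Dividing by the left side gives the formula for 1 - |`diskAut a z`|², on which all the
pseudo-hyperbolic estimates rest. -/
lemma norm_sq_one_sub_conj_mul (a z : ℂ) :
    ‖1 - conj a * z‖ ^ 2 = ‖z - a‖ ^ 2 + (1 - ‖a‖ ^ 2) * (1 - ‖z‖ ^ 2) := by
  simp only [Complex.sq_norm, Complex.normSq_apply, Complex.sub_re, Complex.sub_im, Complex.mul_re,
    Complex.mul_im, Complex.conj_re, Complex.conj_im, Complex.one_re, Complex.one_im]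
  ring

lemma one_sub_norm_sq_pos {z : ℂ} (hz : ‖z‖ < 1) : 0 < 1 - ‖z‖ ^ 2 := by
  nlinarith [norm_nonneg z]

lemma one_sub_norm_sq_diskAut {a z : ℂ} (ha : ‖a‖ < 1) (hz : ‖z‖ < 1) :
    1 - ‖diskAut a z‖ ^ 2 = (1 - ‖a‖ ^ 2) * (1 - ‖z‖ ^ 2) / ‖1 - conj a * z‖ ^ 2 := by
  have h : ‖1 - conj a * z‖ ≠ 0 := norm_ne_zero_iff.2 (one_sub_conj_mul_ne_zero ha.le hz)
  have h2 := norm_sq_one_sub_conj_mul a z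
  rw [diskAut, norm_div, div_pow, eq_div_iff (pow_ne_zero 2 h), sub_mul,
    div_mul_cancel₀ _ (pow_ne_zero 2 h)]
  linarith

lemma norm_diskAut_lt_one {a z : ℂ} (ha : ‖a‖ < 1) (hz : ‖z‖ < 1) : ‖diskAut a z‖ < 1 := by
  have h : 0 < ‖1 - conj a * z‖ := norm_pos_iff.2 (one_sub_conj_mul_ne_zero ha.le hz)
  have h1 := one_sub_norm_sq_diskAut ha hz
  have h2 : 0 < (1 - ‖a‖ ^ 2) * (1 - ‖z‖ ^ 2) / ‖1 - conj a * z‖ ^ 2 := by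
    have := one_sub_norm_sq_pos ha
    have := one_sub_norm_sq_pos hz
    positivity
  rw [← h1] at h2
  nlinarith [norm_nonneg (diskAut a z)]

@[simp] lemma diskAut_self (a : ℂ) : diskAut a a = 0 := by simp [diskAut]

lemma diskAut_neg_zero (a : ℂ) : diskAut (-a) 0 = a := by simp [diskAut]

lemma diskAut_neg_diskAut {a z : ℂ} (ha : ‖a‖ < 1) (hz : ‖z‖ < 1) :
    diskAut (-a) (diskAut a z) = z := by
  have h := one_sub_conj_mul_ne_zero ha.le hz
  have h2 : (1 : ℂ) - conj a * a ≠ 0 := one_sub_conj_mul_ne_zero ha.le ha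
  have h3 : 1 + conj a * diskAut a z = (1 - conj a * a) / (1 - conj a * z) := by
    rw [diskAut, eq_div_iff h, add_mul, mul_assoc, div_mul_cancel₀ _ h]; ring
  have h4 : diskAut a z + a = z * (1 - conj a * a) / (1 - conj a * z) := by
    rw [diskAut, eq_div_iff h, add_mul, div_mul_cancel₀ _ h]; ring
  have : diskAut (-a) (diskAut a z) = (diskAut a z + a) / (1 + conj a * diskAut a z) := by
    rw [diskAut, map_neg]; ring_nf
  rw [this, h3, h4, div_div_div_cancel_right₀ h, mul_div_cancel_right₀ _ h2]

lemma differentiableOn_diskAut {a : ℂ} (ha : ‖a‖ ≤ 1) :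
    DifferentiableOn ℂ (diskAut a) (ball 0 1) := by
  intro z hz
  have := one_sub_conj_mul_ne_zero ha (mem_ball_zero_iff.1 hz)
  unfold diskAut
  fun_prop (disch := assumption)

/-- The **Schwarz-Pick lemma**: a holomorphic self-map of the disk does not increase the
pseudo-hyperbolic distance. -/
theorem norm_diskAut_map_le {φ : ℂ → ℂ} (hd : DifferentiableOn ℂ φ (ball 0 1))
    (hm : MapsTo φ (ball 0 1) (ball 0 1)) {a b : ℂ} (ha : ‖a‖ < 1) (hb : ‖b‖ < 1) :
    ‖diskAut (φ a) (φ b)‖ ≤ ‖diskAut a b‖ := by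
  have hφ : ∀ z : ℂ, ‖z‖ < 1 → ‖φ z‖ < 1 := fun z hz ↦
    mem_ball_zero_iff.1 (hm (mem_ball_zero_iff.2 hz))
  have ha' : ‖-a‖ < 1 := by rwa [norm_neg]
  have hm1 : MapsTo (diskAut (-a)) (ball 0 1) (ball 0 1) := fun z hz ↦
    mem_ball_zero_iff.2 (norm_diskAut_lt_one ha' (mem_ball_zero_iff.1 hz))
  have hm2 : MapsTo (diskAut (φ a)) (ball 0 1) (ball 0 1) := fun z hz ↦
    mem_ball_zero_iff.2 (norm_diskAut_lt_one (hφ a ha) (mem_ball_zero_iff.1 hz))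
  have hF : DifferentiableOn ℂ (diskAut (φ a) ∘ φ ∘ diskAut (-a)) (ball 0 1) :=
    (differentiableOn_diskAut (hφ a ha).le).comp
      (hd.comp (differentiableOn_diskAut ha'.le) hm1) (hm.comp hm1)
  have := Complex.norm_le_norm_of_mapsTo_ball hF
    ((hm2.comp (hm.comp hm1)).mono_right ball_subset_closedBall)
    (by simp [diskAut_neg_zero]) (norm_diskAut_lt_one ha hb)
  simpa [diskAut_neg_diskAut ha hb] using this

/-- A product form of the Schwarz-Pick lemma. -/
theorem schwarz_pick_mul {φ : ℂ → ℂ} (hd : DifferentiableOn ℂ φ (ball 0 1))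
    (hm : MapsTo φ (ball 0 1) (ball 0 1)) {a b : ℂ} (ha : ‖a‖ < 1) (hb : ‖b‖ < 1) :
    (1 - ‖a‖ ^ 2) * (1 - ‖b‖ ^ 2) * ‖1 - conj (φ a) * φ b‖ ^ 2 ≤
      (1 - ‖φ a‖ ^ 2) * (1 - ‖φ b‖ ^ 2) * ‖1 - conj a * b‖ ^ 2 := by
  have ha2 := mem_ball_zero_iff.1 (hm (mem_ball_zero_iff.2 ha))
  have hb2 := mem_ball_zero_iff.1 (hm (mem_ball_zero_iff.2 hb))
  have h1 := one_sub_norm_sq_diskAut ha hb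
  have h2 := one_sub_norm_sq_diskAut ha2 hb2
  have h := pow_le_pow_left₀ (norm_nonneg _) (norm_diskAut_map_le hd hm ha hb) 2
  have e1 : 0 < ‖1 - conj a * b‖ := norm_pos_iff.2 (one_sub_conj_mul_ne_zero ha.le hb)
  have e2 : 0 < ‖1 - conj (φ a) * φ b‖ := norm_pos_iff.2 (one_sub_conj_mul_ne_zero ha2.le hb2)
  have h3 : (1 - ‖a‖ ^ 2) * (1 - ‖b‖ ^ 2) / ‖1 - conj a * b‖ ^ 2 ≤
      (1 - ‖φ a‖ ^ 2) * (1 - ‖φ b‖ ^ 2) / ‖1 - conj (φ a) * φ b‖ ^ 2 := by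
    rw [← h1, ← h2]; linarith
  rwa [div_le_div_iff₀ (by positivity) (by positivity)] at h3

/-- If `‖diskAut a b‖ ≤ ρ`, then `b` is close to `a`. -/
lemma norm_sub_le_of_norm_diskAut_le {a b : ℂ} {ρ : ℝ} (ha : ‖a‖ < 1) (hb : ‖b‖ < 1)
    (h : ‖diskAut a b‖ ≤ ρ) : ‖b - a‖ ≤ 2 * ρ := by
  have e1 : 0 < ‖1 - conj a * b‖ := norm_pos_iff.2 (one_sub_conj_mul_ne_zero ha.le hb)
  rw [diskAut, norm_div, div_le_iff₀ e1] at h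
  have : ‖1 - conj a * b‖ ≤ 2 := by
    calc ‖1 - conj a * b‖ ≤ ‖(1 : ℂ)‖ + ‖conj a * b‖ := norm_sub_le _ _
      _ ≤ 2 := by
        rw [norm_one, norm_mul, RCLike.norm_conj]
        nlinarith [norm_nonneg a, norm_nonneg b]
  have hρ : 0 ≤ ρ := by
    by_contra! hneg
    nlinarith [norm_nonneg (b - a)]
  nlinarith

/-- If `‖diskAut a b‖ ≤ ρ < 1`, then `1 - ‖b‖²` is comparable with `1 - ‖a‖²`. -/
lemma one_sub_norm_sq_mul_le_of_norm_diskAut_le {a b : ℂ} {ρ : ℝ} (ha : ‖a‖ < 1) (hb : ‖b‖ < 1)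
    (h : ‖diskAut a b‖ ≤ ρ) (hρ : ρ < 1) :
    (1 - ‖b‖ ^ 2) * (1 - ρ) ^ 2 ≤ 1 - ‖a‖ ^ 2 := by
  have hρ0 : 0 ≤ ρ := (norm_nonneg _).trans h
  have ha' : ‖-a‖ < 1 := by rwa [norm_neg]
  have hw := norm_diskAut_lt_one ha hb
  have h1 := one_sub_norm_sq_diskAut ha' hw
  rw [diskAut_neg_diskAut ha hb, norm_neg] at h1
  set w := diskAut a b
  have h2 : 1 - ρ ≤ ‖1 - conj (-a) * w‖ := by
    calc 1 - ρ ≤ ‖(1 : ℂ)‖ - ‖conj (-a) * w‖ := by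
          rw [norm_one, norm_mul, RCLike.norm_conj, norm_neg]
          nlinarith [norm_nonneg a, norm_nonneg w]
      _ ≤ _ := norm_sub_norm_le _ _
  have e1 : 0 < ‖1 - conj (-a) * w‖ := by linarith
  rw [h1, div_mul_eq_mul_div, div_le_iff₀ (by positivity)]
  have h3 : (1 - ρ) ^ 2 ≤ ‖1 - conj (-a) * w‖ ^ 2 := pow_le_pow_left₀ (by linarith) h2 2
  have h4 := one_sub_norm_sq_pos ha
  have h5 : 1 - ‖w‖ ^ 2 ≤ 1 := by nlinarith [norm_nonneg w]
  have h6 := one_sub_norm_sq_pos hw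
  calc (1 - ‖a‖ ^ 2) * (1 - ‖w‖ ^ 2) * (1 - ρ) ^ 2
      ≤ (1 - ‖a‖ ^ 2) * 1 * ‖1 - conj (-a) * w‖ ^ 2 := by gcongr
    _ = _ := by ring

/-- The Schwarz-Pick estimate for the derivative of a function with positive real part. -/
lemma norm_deriv_le_of_re_pos {q : ℂ → ℂ} (hd : DifferentiableOn ℂ q (ball 0 1))
    (hq : ∀ z ∈ ball (0 : ℂ) 1, 0 < (q z).re) {z : ℂ} (hz : ‖z‖ < 1) :
    (1 - ‖z‖ ^ 2) * ‖deriv q z‖ ≤ 2 * (q z).re := by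
  have hz' : ‖-z‖ < 1 := by rwa [norm_neg]
  set p := q z with hp
  have hp0 : 0 < p.re := hq z (mem_ball_zero_iff.2 hz)
  have hm1 : MapsTo (diskAut (-z)) (ball 0 1) (ball 0 1) := fun w hw ↦
    mem_ball_zero_iff.2 (norm_diskAut_lt_one hz' (mem_ball_zero_iff.1 hw))
  have hne : ∀ w : ℂ, 0 < w.re → w + conj p ≠ 0 := by
    intro w hw h
    have := congrArg Complex.re h
    simp at this
    linarith
  -- The Cayley map of the right half-plane that sends p to 0. Precomposing with `diskAut (-z)`,
  -- which sends 0 to z, reduces the claim to Schwarz's bound for the derivative at 0.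
  set C : ℂ → ℂ := fun w ↦ (w - p) / (w + conj p) with hC
  have hCd : ∀ w : ℂ, 0 < w.re → DifferentiableAt ℂ C w := by
    intro w hw
    have := hne w hw
    simp only [hC]
    fun_prop (disch := assumption)
  have hCn : ∀ w : ℂ, 0 < w.re → ‖C w‖ ≤ 1 := by
    intro w hw
    have h0 : 0 < ‖w + conj p‖ := norm_pos_iff.2 (hne w hw)
    rw [hC, norm_div, div_le_one h0]
    refine le_of_sq_le_sq ?_ h0.le
    simp only [Complex.sq_norm, Complex.normSq_apply, Complex.sub_re, Complex.sub_im,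
      Complex.add_re, Complex.add_im, Complex.conj_re, Complex.conj_im]
    nlinarith
  have hqm : ∀ w ∈ ball (0 : ℂ) 1, 0 < (q (diskAut (-z) w)).re := fun w hw ↦ hq _ (hm1 hw)
  have h00 : C (q (diskAut (-z) 0)) = 0 := by
    rw [diskAut_neg_zero, ← hp]; simp [hC]
  have hF : DifferentiableOn ℂ (fun w ↦ C (q (diskAut (-z) w))) (ball 0 1) := by
    intro w hw
    exact ((hCd _ (hqm w hw)).comp_differentiableWithinAt w
      ((hd.comp (differentiableOn_diskAut hz'.le) hm1) w hw))
  have hb := Complex.norm_deriv_le_one_of_mapsTo_ball (R := 1) (c := 0) hF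
    (by
      intro w hw
      simp only [h00]
      exact mem_closedBall_zero_iff.2 (hCn _ (hqm w hw))) one_pos
  have d1 : HasDerivAt (diskAut (-z)) (1 - conj z * z) 0 := by
    have : HasDerivAt (fun w : ℂ ↦ (w + z) / (1 + conj z * w))
        ((1 * (1 + conj z * 0) - (0 + z) * (conj z * 1)) / (1 + conj z * 0) ^ 2) 0 :=
      ((hasDerivAt_id (0 : ℂ)).add_const z).div
        (((hasDerivAt_id (0 : ℂ)).const_mul (conj z)).const_add 1) (by simp)
    convert this using 1
    · ext w; simp [diskAut]
    · simp [mul_comm]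
  have d2 : HasDerivAt q (deriv q z) (diskAut (-z) 0) := by
    rw [diskAut_neg_zero]
    exact (hd.differentiableAt (isOpen_ball.mem_nhds (mem_ball_zero_iff.2 hz))).hasDerivAt
  have hpp : p + conj p = (2 * p.re : ℝ) := Complex.add_conj p
  have d3 : HasDerivAt C (1 / (2 * p.re : ℝ)) (q (diskAut (-z) 0)) := by
    rw [diskAut_neg_zero, ← hp]
    have : HasDerivAt C ((1 * (p + conj p) - (p - p) * 1) / (p + conj p) ^ 2) p :=
      ((hasDerivAt_id p).sub_const p).div ((hasDerivAt_id p).add_const (conj p)) (hne p hp0)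
    convert this using 1
    have := hne p hp0
    rw [← hpp]
    field_simp
    ring
  have d4 := (d3.comp (0 : ℂ) (d2.comp (0 : ℂ) d1)).deriv
  have e : C ∘ q ∘ diskAut (-z) = fun w ↦ C (q (diskAut (-z) w)) := rfl
  rw [e] at d4
  rw [d4, norm_mul, norm_mul, norm_div, norm_one, Complex.norm_real, Real.norm_eq_abs,
    abs_of_pos (by linarith)] at hb
  have e2 : ‖1 - conj z * z‖ = 1 - ‖z‖ ^ 2 := by
    rw [mul_comm, Complex.mul_conj, Complex.normSq_eq_norm_sq, ← Complex.ofReal_one,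
      ← Complex.ofReal_sub, Complex.norm_real, Real.norm_eq_abs,
      abs_of_pos (one_sub_norm_sq_pos hz)]
  rw [e2, one_div, inv_mul_le_iff₀ (by linarith)] at hb
  linarith

/-- The Schwarz-Pick estimate for the derivative of a function with nonnegative real part. -/
lemma norm_deriv_le_of_re_nonneg {q : ℂ → ℂ} (hd : DifferentiableOn ℂ q (ball 0 1))
    (hq : ∀ z ∈ ball (0 : ℂ) 1, 0 ≤ (q z).re) {z : ℂ} (hz : ‖z‖ < 1) :
    (1 - ‖z‖ ^ 2) * ‖deriv q z‖ ≤ 2 * (q z).re := by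
  -- Adding ε/2 to q makes its real part positive and costs exactly ε on the right.
  refine le_of_forall_pos_le_add fun ε hε ↦ ?_
  have := norm_deriv_le_of_re_pos (q := fun w ↦ q w + (ε / 2 : ℝ)) (hd.add_const _)
    (fun w hw ↦ by have := hq w hw; simp; linarith) hz
  simp only [deriv_add_const, Complex.add_re, Complex.ofReal_re] at this
  linarith

end DiskAutomorphism

/-! ### Inverses of injective holomorphic functions -/

section InverseFunction

open Metric

variable {f : ℂ → ℂ} {U : Set ℂ}

/-- The open mapping theorem: the alternative, that f is constant near z, contradicts injectivity
because z is not isolated. -/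
lemma nhds_le_map_nhds_of_injOn (hU : IsOpen U) (hf : DifferentiableOn ℂ f U) (hi : InjOn f U)
    {z : ℂ} (hz : z ∈ U) : 𝓝 (f z) ≤ map f (𝓝 z) := by
  rcases (hf.analyticAt (hU.mem_nhds hz)).eventually_constant_or_nhds_le_map_nhds with h | h
  · exfalso
    have h1 : ∀ᶠ w in 𝓝[≠] z, w = z := by
      filter_upwards [nhdsWithin_le_nhds h, nhdsWithin_le_nhds (hU.mem_nhds hz)] with w hw hwU
      exact hi hwU hz hw
    obtain ⟨w, hw, hw'⟩ := (h1.and self_mem_nhdsWithin).exists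
    exact hw' hw
  · exact h

lemma isOpen_image_of_injOn (hU : IsOpen U) (hf : DifferentiableOn ℂ f U) (hi : InjOn f U) :
    IsOpen (f '' U) := by
  rw [isOpen_iff_mem_nhds]
  rintro _ ⟨z, hz, rfl⟩
  exact nhds_le_map_nhds_of_injOn hU hf hi hz (image_mem_map (hU.mem_nhds hz))

lemma continuousAt_invFunOn (hU : IsOpen U) (hf : DifferentiableOn ℂ f U) (hi : InjOn f U)
    {z : ℂ} (hz : z ∈ U) : ContinuousAt (Function.invFunOn f U) (f z) := by
  have hleft := hi.leftInvOn_invFunOn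
  rw [ContinuousAt, hleft hz]
  intro V hV
  have : f '' (V ∩ U) ∈ 𝓝 (f z) :=
    nhds_le_map_nhds_of_injOn hU hf hi hz (image_mem_map (inter_mem hV (hU.mem_nhds hz)))
  refine mem_map.2 (mem_of_superset this ?_)
  rintro _ ⟨w, ⟨hwV, hwU⟩, rfl⟩
  simpa [mem_preimage, hleft hwU] using hwV

lemma hasDerivAt_invFunOn_of_ne_zero (hU : IsOpen U) (hf : DifferentiableOn ℂ f U) (hi : InjOn f U)
    {z : ℂ} (hz : z ∈ U) (h0 : deriv f z ≠ 0) :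
    HasDerivAt (Function.invFunOn f U) (deriv f z)⁻¹ (f z) := by
  have hleft := hi.leftInvOn_invFunOn
  refine HasDerivAt.of_local_left_inverse (f := f) (continuousAt_invFunOn hU hf hi hz) ?_ h0 ?_
  · rw [hleft hz]
    exact (hf.differentiableAt (hU.mem_nhds hz)).hasDerivAt
  · filter_upwards [(isOpen_image_of_injOn hU hf hi).mem_nhds (mem_image_of_mem f hz)] with y hy
    exact Function.invFunOn_eq hy

/-- The derivative of an injective holomorphic function does not vanish. -/
theorem deriv_ne_zero_of_injOn (hU : IsOpen U) (hf : DifferentiableOn ℂ f U) (hi : InjOn f U)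
    {z : ℂ} (hz : z ∈ U) : deriv f z ≠ 0 := by
  have hleft := hi.leftInvOn_invFunOn
  have hfa : AnalyticAt ℂ f z := hf.analyticAt (hU.mem_nhds hz)
  have hUn := hU.mem_nhds hz
  -- Zeros of f' are isolated; otherwise f' vanishes near z and f is constant on a ball.
  have hne : ∀ᶠ w in 𝓝[≠] z, deriv f w ≠ 0 := by
    rcases hfa.deriv.eventually_eq_zero_or_eventually_ne_zero with h | h
    · exfalso
      obtain ⟨r, hr, hrs⟩ := Metric.eventually_nhds_iff_ball.1 (h.and hUn)
      have hc : ∀ w ∈ ball z r, f w = f z := fun w hw ↦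
        (convex_ball z r).is_const_of_fderivWithin_eq_zero (𝕜 := ℂ)
          (hf.mono fun y hy ↦ (hrs y hy).2)
          (fun y hy ↦ by
            rw [fderivWithin_of_isOpen isOpen_ball hy]
            ext
            simpa using (hrs y hy).1) hw (mem_ball_self hr)
      have h1 : ∀ᶠ w in 𝓝[≠] z, w = z := by
        filter_upwards [nhdsWithin_le_nhds (ball_mem_nhds z hr)] with w hw
        exact hi (hrs w hw).2 hz (hc w hw)
      obtain ⟨w, hw, hw'⟩ := (h1.and self_mem_nhdsWithin).exists
      exact hw' hw
    · exact h
  -- The inverse is differentiable on a punctured neighbourhood and continuous at the centre, so the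
  -- singularity is removable. The chain rule for g ∘ f = id then excludes f'(z) = 0.
  have hg : AnalyticAt ℂ (Function.invFunOn f U) (f z) := by
    refine Complex.analyticAt_of_differentiable_on_punctured_nhds_of_continuousAt ?_
      (continuousAt_invFunOn hU hf hi hz)
    rw [eventually_nhdsWithin_iff] at hne ⊢
    have hc : Tendsto (Function.invFunOn f U) (𝓝 (f z)) (𝓝 z) := by
      simpa [ContinuousAt, hleft hz] using continuousAt_invFunOn hU hf hi hz
    filter_upwards [hc hne, (isOpen_image_of_injOn hU hf hi).mem_nhds (mem_image_of_mem f hz)]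
      with y hy hyU hyne
    obtain ⟨w, hw, rfl⟩ := hyU
    rw [mem_preimage, hleft hw] at hy
    exact (hasDerivAt_invFunOn_of_ne_zero hU hf hi hw
      (hy fun h ↦ hyne (by rw [mem_singleton_iff] at h ⊢; rw [h]))).differentiableAt
  intro h0
  have h1 : HasDerivAt (fun w ↦ Function.invFunOn f U (f w))
      (deriv (Function.invFunOn f U) (f z) * deriv f z) z :=
    hg.differentiableAt.hasDerivAt.comp z hfa.differentiableAt.hasDerivAt
  have h2 : HasDerivAt (fun w ↦ Function.invFunOn f U (f w)) 1 z := by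
    refine (hasDerivAt_id z).congr_of_eventuallyEq ?_
    filter_upwards [hUn] with w hw using hleft hw
  have := h1.unique h2
  simp [h0] at this

lemma hasDerivAt_invFunOn (hU : IsOpen U) (hf : DifferentiableOn ℂ f U) (hi : InjOn f U)
    {z : ℂ} (hz : z ∈ U) : HasDerivAt (Function.invFunOn f U) (deriv f z)⁻¹ (f z) :=
  hasDerivAt_invFunOn_of_ne_zero hU hf hi hz (deriv_ne_zero_of_injOn hU hf hi hz)

lemma differentiableOn_invFunOn (hU : IsOpen U) (hf : DifferentiableOn ℂ f U) (hi : InjOn f U) :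
    DifferentiableOn ℂ (Function.invFunOn f U) (f '' U) := by
  rintro _ ⟨z, hz, rfl⟩
  exact (hasDerivAt_invFunOn hU hf hi hz).differentiableAt.differentiableWithinAt

end InverseFunction

/-! ### Recession directions and half-planes of closed convex sets -/

section Recession

/-- `c` is a recession direction of `K`: translating `K` by nonnegative multiples of `c` maps `K`
into itself. -/
def IsRecessionDirection (K : Set ℂ) (c : ℂ) : Prop :=
  ∀ k ∈ K, ∀ t : ℝ, 0 ≤ t → k + t * c ∈ K

variable {K : Set ℂ}

/-- A limit direction of points of a closed convex set that tend to infinity is a recession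
direction. -/
lemma isRecessionDirection_of_tendsto (hK : IsClosed K) (hc : Convex ℝ K) {ι : Type*}
    {l : Filter ι} [l.NeBot] {u : ι → ℂ} (hu : ∀ᶠ i in l, u i ∈ K)
    (hn : Tendsto (fun i ↦ ‖u i‖) l atTop) {c : ℂ}
    (hd : Tendsto (fun i ↦ (‖u i‖ : ℂ)⁻¹ * u i) l (𝓝 c)) : IsRecessionDirection K c := by
  intro k hk t ht
  have h0 : Tendsto (fun i ↦ (‖u i‖ : ℂ)⁻¹) l (𝓝 0) := by
    have := (Complex.continuous_ofReal.tendsto 0).comp (tendsto_inv_atTop_zero.comp hn)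
    simpa [Function.comp_def] using this
  -- These points divide the segment from k to u i at parameter t/‖u i‖, so they lie in K once ‖u i‖
  -- ≥ t; their limit is k + tc.
  have h1 : Tendsto (fun i ↦ k + t * ((‖u i‖ : ℂ)⁻¹ * u i - (‖u i‖ : ℂ)⁻¹ * k)) l
      (𝓝 (k + t * (c - 0 * k))) :=
    ((hd.sub (h0.mul_const k)).const_mul (t : ℂ)).const_add k
  rw [zero_mul, sub_zero] at h1
  refine hK.mem_of_tendsto h1 ?_
  filter_upwards [hu, hn.eventually_ge_atTop t, hn.eventually_gt_atTop 0] with i hi hit hi0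
  have := hc.add_smul_sub_mem hk hi (t := t * ‖u i‖⁻¹)
    ⟨by positivity, by rw [← div_eq_mul_inv]; exact (div_le_one hi0).2 hit⟩
  convert this using 2
  rw [Complex.real_smul]
  push_cast
  ring

/-- An unbounded closed convex set has a recession direction of norm one. -/
lemma exists_isRecessionDirection (hK : IsClosed K) (hc : Convex ℝ K)
    (hb : ¬ Bornology.IsBounded K) : ∃ c : ℂ, ‖c‖ = 1 ∧ IsRecessionDirection K c := by
  have h : ∀ n : ℕ, ∃ u ∈ K, (n : ℝ) + 1 < ‖u‖ := by
    intro n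
    by_contra! h
    exact hb ((Metric.isBounded_closedBall (x := (0 : ℂ)) (r := (n : ℝ) + 1)).subset
      fun u hu ↦ mem_closedBall_zero_iff.2 (h u hu))
  choose u huK hun using h
  have hs : ∀ n, (‖u n‖ : ℂ)⁻¹ * u n ∈ Metric.sphere (0 : ℂ) 1 := by
    intro n
    have : 0 < ‖u n‖ := lt_of_le_of_lt (by positivity) (hun n)
    simp [this.ne']
  obtain ⟨c, hcs, φ, hφ, hlim⟩ := (isCompact_sphere (0 : ℂ) 1).tendsto_subseq hs
  refine ⟨c, by simpa using hcs, isRecessionDirection_of_tendsto (u := u ∘ φ) (l := atTop) hK hc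
    (Eventually.of_forall fun n ↦ huK _) ?_ hlim⟩
  have h1 : Tendsto (fun n ↦ ‖u n‖) atTop atTop :=
    tendsto_atTop_mono (fun n ↦ (by linarith [hun n] : (n : ℝ) ≤ ‖u n‖))
      tendsto_natCast_atTop_atTop
  exact h1.comp hφ.tendsto_atTop

/-- If the ray of argument `θ` meets `K` at arbitrarily large distances, then it is a recession
direction. -/
lemma isRecessionDirection_exp (hK : IsClosed K) (hc : Convex ℝ K) {θ : ℝ}
    (h : ∃ᶠ t : ℝ in atTop, (t : ℂ) * Complex.exp (θ * Complex.I) ∈ K) :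
    IsRecessionDirection K (Complex.exp (θ * Complex.I)) := by
  set S : Set ℝ := {t | (t : ℂ) * Complex.exp (θ * Complex.I) ∈ K}
  have : (atTop ⊓ 𝓟 S : Filter ℝ).NeBot := frequently_mem_iff_neBot.1 h
  have hpos : ∀ᶠ t : ℝ in atTop ⊓ 𝓟 S, 0 < t := (eventually_gt_atTop 0).filter_mono inf_le_left
  have hnorm : ∀ t : ℝ, 0 < t → ‖(t : ℂ) * Complex.exp (θ * Complex.I)‖ = t := by
    intro t ht
    rw [norm_mul, Complex.norm_exp_ofReal_mul_I, mul_one, Complex.norm_real, Real.norm_eq_abs,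
      abs_of_pos ht]
  refine isRecessionDirection_of_tendsto (l := atTop ⊓ 𝓟 S)
    (u := fun t : ℝ ↦ (t : ℂ) * Complex.exp (θ * Complex.I)) hK hc ?_ ?_ ?_
  · exact mem_inf_of_right (mem_principal_self S)
  · refine Tendsto.congr' ?_ (tendsto_id.mono_left inf_le_left)
    filter_upwards [hpos] with t ht using (hnorm t ht).symm
  · refine Tendsto.congr' ?_ tendsto_const_nhds
    filter_upwards [hpos] with t ht
    rw [hnorm t ht, ← mul_assoc, inv_mul_cancel₀ (by exact_mod_cast ht.ne'), one_mul]

/-- The complement of a closed convex set which misses the origin contains a half-plane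
around the origin. -/
lemma exists_halfPlane_subset_compl (hK : IsClosed K) (hc : Convex ℝ K) (hne : K.Nonempty)
    (h0 : (0 : ℂ) ∉ K) : ∃ (n : ℂ) (s : ℝ), ‖n‖ = 1 ∧ 0 < s ∧
      ∀ w : ℂ, (starRingEnd ℂ n * w).re < s → w ∈ Kᶜ := by
  obtain ⟨F, u, hu0, hu⟩ := geometric_hahn_banach_point_closed hc hK h0
  rw [map_zero] at hu0
  -- The vector representing the real-linear functional F, as Re(conj m · w).
  set m : ℂ := ⟨F 1, F Complex.I⟩ with hm
  have hF : ∀ w : ℂ, F w = (starRingEnd ℂ m * w).re := by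
    intro w
    have : w = w.re • (1 : ℂ) + w.im • Complex.I := by
      simp [Complex.re_add_im]
    conv_lhs => rw [this]
    rw [map_add, map_smul, map_smul]
    simp [hm, mul_comm]
  have hm0 : m ≠ 0 := by
    rintro h
    obtain ⟨k, hk⟩ := hne
    have := hu k hk
    rw [hF, h] at this
    simp at this
    linarith
  have hmp : 0 < ‖m‖ := norm_pos_iff.2 hm0
  refine ⟨(‖m‖ : ℂ)⁻¹ * m, ‖m‖⁻¹ * u, by simp [hm0], by positivity, fun w hw hwK ↦ ?_⟩
  have h1 := hu w hwK
  rw [hF] at h1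
  have h2 : (starRingEnd ℂ ((‖m‖ : ℂ)⁻¹ * m) * w).re = ‖m‖⁻¹ * (starRingEnd ℂ m * w).re := by
    rw [map_mul, map_inv₀, Complex.conj_ofReal, ← Complex.ofReal_inv, mul_assoc,
      Complex.re_ofReal_mul]
  rw [h2] at hw
  have := lt_of_mul_lt_mul_left hw (by positivity)
  linarith

end Recession

/-! ### Unboundedness of the complement -/

section Unbounded

open Metric

/-- If an injective holomorphic function on the disk tends to infinity at a boundary point, then
the complement of its image is unbounded. -/
theorem not_isBounded_compl_image {f : ℂ → ℂ} (hf : DifferentiableOn ℂ f (ball 0 1))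
    (hi : InjOn f (ball 0 1)) (hinf : Tendsto f (𝓝[ball 0 1] 1) (Bornology.cobounded ℂ)) :
    ¬ Bornology.IsBounded (f '' ball 0 1)ᶜ := by
  intro hb
  obtain ⟨R, hR0, hR⟩ := hb.subset_ball_lt 0 0
  set g := Function.invFunOn f (ball 0 1) with hg
  have hleft := hi.leftInvOn_invFunOn
  have hgd := differentiableOn_invFunOn isOpen_ball hf hi
  have hΩo := isOpen_image_of_injOn isOpen_ball hf hi
  have hinv : ∀ w ∈ ball (0 : ℂ) R⁻¹ \ {0}, w⁻¹ ∈ f '' ball 0 1 := by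
    rintro w ⟨hw, hw0⟩
    by_contra h
    have h1 := mem_ball_zero_iff.1 (hR h)
    rw [mem_ball_zero_iff] at hw
    have h0 : 0 < ‖w‖ := norm_pos_iff.2 hw0
    rw [norm_inv] at h1
    have := (inv_lt_inv₀ hR0 (inv_pos.2 h0)).2 h1
    rw [inv_inv] at this
    linarith
  -- If K were bounded, the inverse g of f would be defined near ∞. In the coordinate 1/w it is
  -- bounded, so it extends to 0 with value 1 because f(z) → ∞ as z → 1. That is an interior maximum
  -- of the modulus, yet the modulus is below 1 off 0.
  set G : ℂ → ℂ := fun w ↦ g w⁻¹ with hG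
  have hGn : ∀ w ∈ ball (0 : ℂ) R⁻¹ \ {0}, ‖G w‖ < 1 := by
    intro w hw
    exact mem_ball_zero_iff.1 (Function.invFunOn_mem (hinv w hw))
  have hGd : DifferentiableOn ℂ G (ball (0 : ℂ) R⁻¹ \ {0}) :=
    hgd.comp (differentiableOn_inv.mono fun w hw ↦ hw.2) hinv
  have hball : ball (0 : ℂ) R⁻¹ ∈ 𝓝 0 := ball_mem_nhds _ (inv_pos.2 hR0)
  have hG' := Complex.differentiableOn_update_limUnder_of_bddAbove hball hGd
    ⟨1, by rintro _ ⟨w, hw, rfl⟩; exact (hGn w hw).le⟩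
  set G' := Function.update G 0 (limUnder (𝓝[≠] 0) G) with hG'def
  have hne : ∀ w : ℂ, w ≠ 0 → G' w = G w := fun w hw ↦ Function.update_of_ne hw _ _
  have hmem1 : (1 : ℂ) ∈ closure (ball (0 : ℂ) 1) := by
    rw [closure_ball _ one_ne_zero]; simp
  have : (𝓝[ball (0 : ℂ) 1] 1).NeBot := mem_closure_iff_nhdsWithin_neBot.1 hmem1
  have hG0 : G' 0 = 1 := by
    have h1 : Tendsto (fun z ↦ (f z)⁻¹) (𝓝[ball 0 1] 1) (𝓝 0) :=
      (tendsto_inv₀_cobounded (α := ℂ)).comp hinf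
    have h2 : Tendsto (fun z ↦ G' (f z)⁻¹) (𝓝[ball 0 1] 1) (𝓝 (G' 0)) :=
      ((hG'.differentiableAt hball).continuousAt.tendsto).comp h1
    have h3 : Tendsto (fun z : ℂ ↦ z) (𝓝[ball 0 1] 1) (𝓝 1) := tendsto_id.mono_left inf_le_left
    refine tendsto_nhds_unique h2 (h3.congr' ?_)
    have h4 : ∀ᶠ z in 𝓝[ball 0 1] 1, f z ≠ 0 :=
      hinf.eventually (Bornology.eventually_ne_cobounded 0)
    filter_upwards [self_mem_nhdsWithin, h4] with z hz hz0
    rw [hne _ (inv_ne_zero hz0), hG]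
    simp only [inv_inv]
    exact (hleft hz).symm
  have hmax : IsLocalMax (norm ∘ G') 0 := by
    filter_upwards [hball] with w hw
    by_cases h : w = 0
    · rw [h]
    · simp only [Function.comp, hG0, norm_one, hne w h]
      exact (hGn w ⟨hw, h⟩).le
  have hconst := Complex.eventually_eq_of_isLocalMax_norm
    ((hG'.eventually_differentiableAt hball)) hmax
  have hcontra : ∀ᶠ w in 𝓝[≠] (0 : ℂ), False := by
    filter_upwards [nhdsWithin_le_nhds hconst, nhdsWithin_le_nhds hball, self_mem_nhdsWithin]
      with w hw hwb hw0
    have := hGn w ⟨hwb, hw0⟩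
    rw [← hne w hw0, hw, hG0, norm_one] at this
    exact lt_irrefl _ this
  exact hcontra.exists.elim fun _ h ↦ h

end Unbounded

/-! ### Invariant horodisks and the Berkson-Porta inequality -/

section Horocycle

open Metric ComplexConjugate

variable {f : ℂ → ℂ}

/-- If `f` maps the disk injectively onto a domain containing the ball of radius `R` around `w`,
then the preimages of `w` and `w - c` have pseudo-hyperbolic distance at most `‖c‖ / R`. -/
lemma norm_diskAut_invFunOn_le (hf : DifferentiableOn ℂ f (ball 0 1)) (hi : InjOn f (ball 0 1))
    {w c : ℂ} {R : ℝ} (hR : ball w R ⊆ f '' ball 0 1) (hc : ‖c‖ < R) :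
    ‖diskAut (Function.invFunOn f (ball 0 1) w) (Function.invFunOn f (ball 0 1) (w - c))‖ ≤
      ‖c‖ / R := by
  set g := Function.invFunOn f (ball 0 1) with hg
  have hR0 : 0 < R := (norm_nonneg c).trans_lt hc
  -- Rescaling the ball to the unit disk, w becomes 0 and w - c becomes -c/R; Schwarz-Pick does the
  -- rest.
  have hm : MapsTo (fun ζ : ℂ ↦ w + R * ζ) (ball 0 1) (f '' ball 0 1) := by
    intro ζ hζ
    apply hR
    rw [mem_ball_zero_iff] at hζ
    rw [mem_ball_iff_norm, add_sub_cancel_left, norm_mul, Complex.norm_real, Real.norm_eq_abs,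
      abs_of_pos hR0]
    nlinarith
  have hd : DifferentiableOn ℂ (fun ζ : ℂ ↦ g (w + R * ζ)) (ball 0 1) :=
    (differentiableOn_invFunOn isOpen_ball hf hi).comp (by fun_prop) hm
  have hb : ‖-c / (R : ℂ)‖ = ‖c‖ / R := by
    rw [norm_div, norm_neg, Complex.norm_real, Real.norm_eq_abs, abs_of_pos hR0]
  have h := norm_diskAut_map_le hd (fun ζ hζ ↦ Function.invFunOn_mem (hm hζ)) (a := 0)
    (b := -c / (R : ℂ)) (by simp) (by rw [hb]; exact (div_lt_one hR0).2 hc)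
  have e : (w + R * (-c / (R : ℂ))) = w - c := by
    have : (R : ℂ) ≠ 0 := by exact_mod_cast hR0.ne'
    field_simp
    ring
  rw [e] at h
  simpa [diskAut, hb, abs_of_pos hR0] using h

lemma norm_one_sub_conj_mul_of_norm_eq_one {τ : ℂ} (hτ : ‖τ‖ = 1) (z : ℂ) :
    ‖1 - conj τ * z‖ = ‖τ - z‖ := by
  have h : conj τ * τ = 1 := by
    rw [mul_comm, Complex.mul_conj, Complex.normSq_eq_norm_sq, hτ]; simp
  have : 1 - conj τ * z = conj τ * (τ - z) := by rw [mul_sub, h]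
  rw [this, norm_mul, RCLike.norm_conj, hτ, one_mul]

/-- A version of **Julia's lemma**: if `Ω = f(𝔻)` satisfies `Ω - c ⊆ Ω` and `w j` are points of `Ω`
whose distance to the complement of `Ω` tends to infinity, then the self-map of the disk induced
by the translation by `-c` preserves the horodisks at the limit of the preimages of `w j`. -/
theorem horodisk_invariant (hf : DifferentiableOn ℂ f (ball 0 1)) (hi : InjOn f (ball 0 1))
    {c : ℂ} (hc : ∀ w ∈ f '' ball 0 1, w - c ∈ f '' ball 0 1) {w : ℕ → ℂ}
    (hw : ∀ R : ℝ, ∀ᶠ j in atTop, ball (w j) R ⊆ f '' ball 0 1) {τ : ℂ} (hτ : ‖τ‖ = 1)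
    (hlim : Tendsto (fun j ↦ Function.invFunOn f (ball 0 1) (w j)) atTop (𝓝 τ)) {z : ℂ}
    (hz : ‖z‖ < 1) :
    (1 - ‖z‖ ^ 2) * ‖τ - Function.invFunOn f (ball 0 1) (f z - c)‖ ^ 2 ≤
      (1 - ‖Function.invFunOn f (ball 0 1) (f z - c)‖ ^ 2) * ‖τ - z‖ ^ 2 := by
  set g := Function.invFunOn f (ball 0 1) with hg
  have hleft := hi.leftInvOn_invFunOn
  have hgm : MapsTo g (f '' ball 0 1) (ball 0 1) := fun w hw ↦ Function.invFunOn_mem hw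
  have hφm : MapsTo (fun ζ ↦ g (f ζ - c)) (ball 0 1) (ball 0 1) := fun ζ hζ ↦
    hgm (hc _ (mem_image_of_mem f hζ))
  have hφd : DifferentiableOn ℂ (fun ζ ↦ g (f ζ - c)) (ball 0 1) :=
    (differentiableOn_invFunOn isOpen_ball hf hi).comp (hf.sub_const c)
      (fun ζ hζ ↦ hc _ (mem_image_of_mem f hζ))
  have hwΩ : ∀ᶠ j in atTop, w j ∈ f '' ball 0 1 := by
    filter_upwards [hw 1] with j hj using hj (mem_ball_self one_pos)
  set ρ : ℕ → ℝ := fun j ↦ ‖diskAut (g (w j)) (g (w j - c))‖ with hρ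
  have hρlim : Tendsto ρ atTop (𝓝 0) := by
    rw [Metric.tendsto_nhds]
    intro ε hε
    -- Chosen so that both ‖c‖ < R and ‖c‖ / R < ε.
    set R := (‖c‖ + 1) * (1 + ε⁻¹) with hR
    have hεi : 0 < ε⁻¹ := inv_pos.2 hε
    have hcR : ‖c‖ < R := by nlinarith [norm_nonneg c]
    filter_upwards [hw R] with j hj
    have h1 := norm_diskAut_invFunOn_le hf hi hj hcR
    rw [Real.dist_eq, sub_zero, abs_of_nonneg (norm_nonneg _)]
    refine h1.trans_lt ?_
    rw [div_lt_iff₀ ((norm_nonneg c).trans_lt hcR)]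
    have : ε * R = (‖c‖ + 1) * (ε + 1) := by rw [hR]; field_simp
    nlinarith [norm_nonneg c]
  have hblim : Tendsto (fun j ↦ g (w j - c)) atTop (𝓝 τ) := by
    have h1 : Tendsto (fun j ↦ g (w j - c) - g (w j)) atTop (𝓝 0) := by
      refine squeeze_zero_norm' ?_ (by simpa using hρlim.const_mul 2)
      filter_upwards [hwΩ] with j hj
      exact norm_sub_le_of_norm_diskAut_le (mem_ball_zero_iff.1 (hgm hj))
        (mem_ball_zero_iff.1 (hgm (hc _ hj))) le_rfl
    simpa using h1.add hlim
  -- Schwarz-Pick for the self-map at the points g(w j) and z. Both factors 1 - |g(w j)|² and 1 -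
  -- |g(w j - c)|² degenerate in the limit, but they agree up to (1 - ρ j)², so the former can be
  -- cancelled before letting j → ∞.
  have hineq : ∀ᶠ j in atTop,
      (1 - ‖z‖ ^ 2) * ‖1 - conj (g (w j - c)) * g (f z - c)‖ ^ 2 * (1 - ρ j) ^ 2 ≤
        (1 - ‖g (f z - c)‖ ^ 2) * ‖1 - conj (g (w j)) * z‖ ^ 2 := by
    filter_upwards [hwΩ, hρlim.eventually_lt_const one_pos] with j hj hj1
    have ha := mem_ball_zero_iff.1 (hgm hj)
    have hb := mem_ball_zero_iff.1 (hgm (hc _ hj))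
    have h1 := schwarz_pick_mul hφd hφm ha hz
    have e : f (g (w j)) = w j := Function.invFunOn_eq hj
    simp only [e] at h1
    have h2 := one_sub_norm_sq_mul_le_of_norm_diskAut_le ha hb le_rfl hj1
    have ha0 := one_sub_norm_sq_pos ha
    have hz0 := one_sub_norm_sq_pos (mem_ball_zero_iff.1 (hφm (mem_ball_zero_iff.2 hz)))
    refine le_of_mul_le_mul_left ?_ ha0
    calc _ = ((1 - ‖g (w j)‖ ^ 2) * (1 - ‖z‖ ^ 2) *
            ‖1 - conj (g (w j - c)) * g (f z - c)‖ ^ 2) * (1 - ρ j) ^ 2 := by ring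
      _ ≤ ((1 - ‖g (w j - c)‖ ^ 2) * (1 - ‖g (f z - c)‖ ^ 2) *
            ‖1 - conj (g (w j)) * z‖ ^ 2) * (1 - ρ j) ^ 2 := by gcongr
      _ = ((1 - ‖g (w j - c)‖ ^ 2) * (1 - ρ j) ^ 2) * ((1 - ‖g (f z - c)‖ ^ 2) *
            ‖1 - conj (g (w j)) * z‖ ^ 2) := by ring
      _ ≤ _ := by
        gcongr
  have hcont : Continuous fun ζ : ℂ ↦ conj ζ := Complex.continuous_conj
  have hL : Tendsto (fun j ↦ (1 - ‖z‖ ^ 2) * ‖1 - conj (g (w j - c)) * g (f z - c)‖ ^ 2 *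
      (1 - ρ j) ^ 2) atTop
      (𝓝 ((1 - ‖z‖ ^ 2) * ‖1 - conj τ * g (f z - c)‖ ^ 2 * (1 - 0) ^ 2)) :=
    (((((hcont.tendsto τ).comp hblim).mul_const _).const_sub 1).norm.pow 2 |>.const_mul _).mul
      ((hρlim.const_sub 1).pow 2)
  have hR : Tendsto (fun j ↦ (1 - ‖g (f z - c)‖ ^ 2) * ‖1 - conj (g (w j)) * z‖ ^ 2) atTop
      (𝓝 ((1 - ‖g (f z - c)‖ ^ 2) * ‖1 - conj τ * z‖ ^ 2)) :=
    ((((hcont.tendsto τ).comp hlim).mul_const _).const_sub 1).norm.pow 2 |>.const_mul _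
  have := le_of_tendsto_of_tendsto hL hR hineq
  simpa [norm_one_sub_conj_mul_of_norm_eq_one hτ] using this

/-- The infinitesimal form of the invariance of horodisks: a Berkson-Porta type inequality. -/
theorem re_conj_mul_nonneg_of_horodisk_invariant (hf : DifferentiableOn ℂ f (ball 0 1))
    (hi : InjOn f (ball 0 1)) {τ c : ℂ} (hτ : ‖τ‖ = 1) {z : ℂ} (hz : ‖z‖ < 1)
    (hmem : ∀ t : ℝ, 0 ≤ t → f z - t * c ∈ f '' ball 0 1)
    (h : ∀ t : ℝ, 0 ≤ t →
      (1 - ‖z‖ ^ 2) * ‖τ - Function.invFunOn f (ball 0 1) (f z - t * c)‖ ^ 2 ≤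
        (1 - ‖Function.invFunOn f (ball 0 1) (f z - t * c)‖ ^ 2) * ‖τ - z‖ ^ 2) :
    0 ≤ (conj c * (-conj τ * (τ - z) ^ 2 * deriv f z)).re := by
  set g := Function.invFunOn f (ball 0 1) with hg
  have hzb : z ∈ ball (0 : ℂ) 1 := mem_ball_zero_iff.2 hz
  have hgz : g (f z) = z := hi.leftInvOn_invFunOn hzb
  have hne : ∀ ζ : ℂ, ‖ζ‖ < 1 → τ - ζ ≠ 0 := by
    intro ζ hζ h0
    rw [sub_eq_zero] at h0
    rw [← h0, hτ] at hζ
    exact lt_irrefl _ hζ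
  -- M carries the horodisks at τ to the half-planes Re > const, so invariance says that Re M at
  -- time t is at least its value at time 0; hence its right derivative there is nonnegative.
  set M : ℂ → ℂ := fun ζ ↦ (τ + ζ) / (τ - ζ) with hM
  have hMre : ∀ ζ : ℂ, (M ζ).re = (1 - ‖ζ‖ ^ 2) / ‖τ - ζ‖ ^ 2 := by
    intro ζ
    have h1 : τ.re * τ.re + τ.im * τ.im = 1 := by
      rw [← Complex.normSq_apply, Complex.normSq_eq_norm_sq, hτ, one_pow]
    rw [hM, Complex.div_re, ← add_div, Complex.sq_norm, Complex.sq_norm]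
    congr 1
    simp only [Complex.add_re, Complex.add_im, Complex.sub_re, Complex.sub_im,
      Complex.normSq_apply]
    linear_combination h1
  have hMd : HasDerivAt M (2 * τ / (τ - z) ^ 2) (g (f z - (0 : ℝ) * c)) := by
    have : HasDerivAt M ((1 * (τ - z) - (τ + z) * (-1)) / (τ - z) ^ 2) z :=
      ((hasDerivAt_id z).const_add τ).div ((hasDerivAt_id z).const_sub τ) (hne z hz)
    simp only [Complex.ofReal_zero, zero_mul, sub_zero, hgz]
    convert this using 1
    ring
  have hgd : HasDerivAt g (deriv f z)⁻¹ (f z - (0 : ℝ) * c) := by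
    simpa using hasDerivAt_invFunOn isOpen_ball hf hi hzb
  have htd : HasDerivAt (fun t : ℝ ↦ f z - t * c) (-(1 * c)) 0 :=
    ((Complex.ofRealCLM.hasDerivAt (x := (0 : ℝ))).mul_const c).const_sub (f z)
  have hFc : HasDerivAt (fun t : ℝ ↦ M (g (f z - t * c)))
      (2 * τ / (τ - z) ^ 2 * ((deriv f z)⁻¹ * (-(1 * c)))) 0 := by
    have h1 : HasDerivAt (fun t : ℝ ↦ g (f z - t * c)) ((deriv f z)⁻¹ * (-(1 * c))) 0 :=
      HasDerivAt.comp (h := fun t : ℝ ↦ f z - t * c) (0 : ℝ) hgd htd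
    exact HasDerivAt.comp (h := fun t : ℝ ↦ g (f z - t * c)) (0 : ℝ) hMd h1
  have hF : HasDerivAt (fun t : ℝ ↦ (M (g (f z - t * c))).re)
      (2 * τ / (τ - z) ^ 2 * ((deriv f z)⁻¹ * (-(1 * c)))).re 0 :=
    Complex.reCLM.hasFDerivAt.comp_hasDerivAt (0 : ℝ) hFc
  have hslope := hF.tendsto_slope_zero_right
  have hnonneg : 0 ≤ (2 * τ / (τ - z) ^ 2 * ((deriv f z)⁻¹ * (-(1 * c)))).re := by
    refine ge_of_tendsto hslope ?_
    filter_upwards [self_mem_nhdsWithin] with t ht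
    have ht : 0 < t := ht
    have hp : 0 ≤ t⁻¹ := (inv_pos.2 ht).le
    rw [smul_eq_mul]
    refine mul_nonneg hp (sub_nonneg.2 ?_)
    have hφ : ‖g (f z - t * c)‖ < 1 :=
      mem_ball_zero_iff.1 (Function.invFunOn_mem (hmem t ht.le))
    have p1 : 0 < ‖τ - z‖ := norm_pos_iff.2 (hne z hz)
    have p2 : 0 < ‖τ - g (f z - t * c)‖ := norm_pos_iff.2 (hne _ hφ)
    simp only [zero_add, Complex.ofReal_zero, zero_mul, sub_zero, hgz]
    rw [hMre, hMre, div_le_div_iff₀ (by positivity) (by positivity)]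
    exact h t ht.le
  set D := -conj τ * (τ - z) ^ 2 * deriv f z with hD
  have hττ : τ * conj τ = 1 := by
    rw [Complex.mul_conj, Complex.normSq_eq_norm_sq, hτ]; simp
  have hτ0 : τ ≠ 0 := left_ne_zero_of_mul_eq_one hττ
  have hd0 : deriv f z ≠ 0 := deriv_ne_zero_of_injOn isOpen_ball hf hi hzb
  have hD0 : D ≠ 0 := by
    rw [hD]
    exact mul_ne_zero (mul_ne_zero (neg_ne_zero.2 (right_ne_zero_of_mul_eq_one hττ))
      (pow_ne_zero 2 (hne z hz))) hd0
  have hz0 := hne z hz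
  have e : 2 * τ / (τ - z) ^ 2 * ((deriv f z)⁻¹ * (-(1 * c))) = 2 * (c / D) := by
    rw [hD]
    have : conj τ = τ⁻¹ := eq_inv_of_mul_eq_one_right hττ
    rw [this]
    field_simp
  -- Thus Re(conj c · D) and Re(c / D) have the same sign.
  have e2 : conj c * D = conj ((Complex.normSq D : ℂ) * (c / D)) := by
    rw [Complex.normSq_eq_conj_mul_self]
    have : conj D * D * (c / D) = conj D * c := by field_simp
    rw [this, map_mul, Complex.conj_conj, mul_comm]
  rw [e2, Complex.conj_re, Complex.re_ofReal_mul]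
  rw [e] at hnonneg
  have h3 : (2 * (c / D)).re = 2 * (c / D).re := by simp
  rw [h3] at hnonneg
  exact mul_nonneg (Complex.normSq_nonneg D) (by linarith)

/-- For a conformal map onto the complement of a convex set there is a boundary point `τ` such
that `-conj τ * (τ - z) ^ 2 * f' z` lies in the dual cone of the recession cone of that set. -/
theorem exists_re_conj_mul_nonneg (hf : DifferentiableOn ℂ f (ball 0 1))
    (hi : InjOn f (ball 0 1)) (h0 : f 0 = 0) (hc : Convex ℝ (f '' ball 0 1)ᶜ)
    (hne : (f '' ball 0 1)ᶜ.Nonempty) :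
    ∃ τ : ℂ, ‖τ‖ = 1 ∧ ∀ c : ℂ, IsRecessionDirection (f '' ball 0 1)ᶜ c →
      ∀ z ∈ ball (0 : ℂ) 1, 0 ≤ (conj c * (-conj τ * (τ - z) ^ 2 * deriv f z)).re := by
  have hΩo := isOpen_image_of_injOn isOpen_ball hf hi
  have h0Ω : (0 : ℂ) ∉ (f '' ball 0 1)ᶜ := fun h ↦ h ⟨0, mem_ball_self one_pos, h0⟩
  obtain ⟨n, s, hn, hs, hH⟩ := exists_halfPlane_subset_compl hΩo.isClosed_compl hc hne h0Ω
  rw [compl_compl] at hH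
  set g := Function.invFunOn f (ball 0 1) with hg
  -- Moving straight away from the separating line: w j is the centre of a ball of radius j inside
  -- Ω.
  set w : ℕ → ℂ := fun j ↦ -(j : ℂ) * n with hw
  have hnn : conj n * n = 1 := by
    rw [mul_comm, Complex.mul_conj, Complex.normSq_eq_norm_sq, hn]; simp
  have hball : ∀ R : ℝ, ∀ j : ℕ, R ≤ j → ball (w j) R ⊆ f '' ball 0 1 := by
    intro R j hj v hv
    apply hH
    rw [mem_ball_iff_norm] at hv
    have h1 : conj n * v = conj n * (v - w j) + ((-(j : ℝ) : ℝ) : ℂ) := by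
      rw [hw]
      push_cast
      linear_combination (-(j : ℂ)) * hnn
    have h2 : (conj n * (v - w j)).re ≤ ‖v - w j‖ := by
      refine (Complex.re_le_norm _).trans ?_
      rw [norm_mul, RCLike.norm_conj, hn, one_mul]
    rw [h1, Complex.add_re, Complex.ofReal_re]
    linarith
  have hwΩ : ∀ j, w j ∈ f '' ball 0 1 := by
    intro j
    apply hH
    have : conj n * w j = ((-(j : ℝ) : ℝ) : ℂ) := by
      rw [hw]
      push_cast
      linear_combination (-(j : ℂ)) * hnn
    rw [this, Complex.ofReal_re]
    have : (0 : ℝ) ≤ j := Nat.cast_nonneg j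
    linarith
  have hgw : ∀ j, g (w j) ∈ ball (0 : ℂ) 1 := fun j ↦ Function.invFunOn_mem (hwΩ j)
  obtain ⟨τ, hτc, σ, hσ, hlim⟩ := (isCompact_closedBall (0 : ℂ) 1).tendsto_subseq
    fun j ↦ ball_subset_closedBall (hgw j)
  have hwn : Tendsto (fun j ↦ ‖w (σ j)‖) atTop atTop := by
    have : (fun j ↦ ‖w (σ j)‖) = fun j ↦ ((σ j : ℕ) : ℝ) := by
      ext j
      simp [hw, hn]
    rw [this]
    exact tendsto_natCast_atTop_atTop.comp hσ.tendsto_atTop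
  -- A limit inside the disk would make f(g(w j)) = w j converge along the subsequence, although |w
  -- j| → ∞.
  have hτ : ‖τ‖ = 1 := by
    refine le_antisymm (mem_closedBall_zero_iff.1 hτc) (not_lt.1 fun hlt ↦ ?_)
    have h1 : ContinuousAt f τ :=
      (hf.differentiableAt (isOpen_ball.mem_nhds (mem_ball_zero_iff.2 hlt))).continuousAt
    have h2 := (h1.tendsto.comp hlim).norm
    have h3 : (fun j ↦ ‖(f ∘ (fun j ↦ g (w j)) ∘ σ) j‖) = fun j ↦ ‖w (σ j)‖ := by
      ext j
      simp only [Function.comp]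
      rw [Function.invFunOn_eq (hwΩ (σ j))]
    exact not_tendsto_nhds_of_tendsto_atTop hwn _ (h3 ▸ h2)
  -- τ depends only on the sequence w, so a single τ serves all recession directions.
  refine ⟨τ, hτ, fun c hcr z hz ↦ ?_⟩
  have htr : ∀ t : ℝ, 0 ≤ t → ∀ v ∈ f '' ball 0 1, v - t * c ∈ f '' ball 0 1 := by
    intro t ht v hv
    by_contra hcon
    have := hcr _ hcon t ht
    rw [sub_add_cancel] at this
    exact this hv
  have hz1 := mem_ball_zero_iff.1 hz
  refine re_conj_mul_nonneg_of_horodisk_invariant hf hi hτ hz1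
    (fun t ht ↦ htr t ht _ (mem_image_of_mem f hz)) fun t ht ↦ ?_
  refine horodisk_invariant hf hi (htr t ht) (w := w ∘ σ) (fun R ↦ ?_) hτ hlim hz1
  filter_upwards [(tendsto_natCast_atTop_atTop (R := ℝ)).comp hσ.tendsto_atTop
    |>.eventually_ge_atTop R] with j hj
  exact hball R _ hj

end Horocycle

/-! ### Functions with values in a sector -/

section Sector

open Metric

lemma exists_abs_sub_le_half {S : Set ℝ} {d : ℝ} (h : ∀ x ∈ S, ∀ y ∈ S, x - y ≤ d) :
    ∃ β : ℝ, ∀ x ∈ S, |x - β| ≤ d / 2 := by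
  -- The midpoint of [sSup S - d, sSup S], an interval that contains S.
  refine ⟨sSup S - d / 2, fun x hx ↦ ?_⟩
  have h1 : x ≤ sSup S := le_csSup ⟨x + d, fun y hy ↦ by linarith [h y hy x hx]⟩ hx
  have h2 : sSup S ≤ x + d := csSup_le ⟨x, hx⟩ fun y hy ↦ by linarith [h y hy x hx]
  rw [abs_le]
  constructor <;> linarith

/-- The logarithmic derivative of a function on the disk with values in a sector of opening
angle `π * κ`. -/
theorem norm_logDeriv_le_of_arg_sub_arg_le {k : ℂ → ℂ} {κ : ℝ} (hκ : 0 < κ)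
    (hd : DifferentiableOn ℂ k (ball 0 1)) (h0 : ∀ z ∈ ball (0 : ℂ) 1, k z ≠ 0)
    (hre : ∀ z ∈ ball (0 : ℂ) 1, 0 ≤ (k z).re)
    (harg : ∀ z ∈ ball (0 : ℂ) 1, ∀ w ∈ ball (0 : ℂ) 1,
      (k z).arg - (k w).arg ≤ Real.pi * κ) {z : ℂ} (hz : ‖z‖ < 1) :
    (1 - ‖z‖ ^ 2) * ‖deriv k z / k z‖ ≤ 2 * κ := by
  obtain ⟨β, hβ⟩ := exists_abs_sub_le_half (S := (fun w ↦ (k w).arg) '' ball (0 : ℂ) 1)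
    (d := Real.pi * κ) (by rintro _ ⟨z, hz, rfl⟩ _ ⟨w, hw, rfl⟩; exact harg z hz w hw)
  have hslit : ∀ w ∈ ball (0 : ℂ) 1, k w ∈ Complex.slitPlane := by
    intro w hw
    rcases (hre w hw).lt_or_eq with h | h
    · exact Or.inl h
    · exact Or.inr fun him ↦ h0 w hw (Complex.ext h.symm him)
  -- Rotating the sector's axis to the positive reals and taking the power 1/κ opens the sector to
  -- the right half-plane. Since q'/q = (k'/k)/κ and Re q ≤ |q|, the half-plane estimate for q'
  -- gives the claim.
  set q : ℂ → ℂ := fun w ↦ Complex.exp ((Complex.log (k w) - β * Complex.I) / κ) with hq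
  have hκ0 : (κ : ℂ) ≠ 0 := by exact_mod_cast hκ.ne'
  have hqd : ∀ w ∈ ball (0 : ℂ) 1, HasDerivAt q (q w * ((deriv k w / k w) / κ)) w := by
    intro w hw
    have h1 := (hd.differentiableAt (isOpen_ball.mem_nhds hw)).hasDerivAt
    exact (((h1.clog (hslit w hw)).sub_const _).div_const _).cexp
  have hqre : ∀ w ∈ ball (0 : ℂ) 1, 0 ≤ (q w).re := by
    intro w hw
    have h1 := hβ _ ⟨w, hw, rfl⟩
    rw [hq, Complex.exp_re]
    refine mul_nonneg (Real.exp_pos _).le (Real.cos_nonneg_of_mem_Icc ?_)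
    have : ((Complex.log (k w) - β * Complex.I) / κ).im = ((k w).arg - β) / κ := by
      rw [Complex.div_ofReal_im]
      simp [Complex.log_im]
    rw [this, mem_Icc, ← abs_le, abs_div, abs_of_pos hκ, div_le_iff₀ hκ]
    simp only at h1
    linarith
  have hb := norm_deriv_le_of_re_nonneg
    (fun w hw ↦ (hqd w hw).differentiableAt.differentiableWithinAt) hqre hz
  rw [(hqd z (mem_ball_zero_iff.2 hz)).deriv, norm_mul, norm_div _ (κ : ℂ), Complex.norm_real,
    Real.norm_eq_abs, abs_of_pos hκ] at hb
  have hq0 : 0 < ‖q z‖ := norm_pos_iff.2 (Complex.exp_ne_zero _)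
  have h1 : (q z).re ≤ ‖q z‖ := Complex.re_le_norm _
  have h2 : ‖q z‖ * ((1 - ‖z‖ ^ 2) * ‖deriv k z / k z‖ / κ) ≤ ‖q z‖ * 2 := by
    calc _ = (1 - ‖z‖ ^ 2) * (‖q z‖ * (‖deriv k z / k z‖ / κ)) := by ring
      _ ≤ 2 * (q z).re := hb
      _ ≤ _ := by linarith
  have h3 := le_of_mul_le_mul_left h2 hq0
  rwa [div_le_iff₀ hκ] at h3

end Sector

/-! ### Measuring sets of directions -/

section OpeningAngle

/-- Two closed half-planes through the origin whose normals form the angle `ψ₂ - ψ₁` meet in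
a sector of opening angle `π - (ψ₂ - ψ₁)`. -/
lemma volume_cos_nonneg_inter_le {ψ₁ ψ₂ : ℝ} (hπ : ψ₂ - ψ₁ ≤ Real.pi) :
    volume ({θ : ℝ | 0 ≤ Real.cos (ψ₁ - θ) ∧ 0 ≤ Real.cos (ψ₂ - θ)} ∩ Ioc (-Real.pi) Real.pi) ≤
      ENNReal.ofReal (Real.pi - (ψ₂ - ψ₁)) := by
  set A := {θ : ℝ | 0 ≤ Real.cos (ψ₁ - θ) ∧ 0 ≤ Real.cos (ψ₂ - θ)} with hA
  have hAm : MeasurableSet A := by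
    refine IsClosed.measurableSet (IsClosed.inter ?_ ?_)
    · exact isClosed_le continuous_const
        (Real.continuous_cos.comp (continuous_const.sub continuous_id))
    · exact isClosed_le continuous_const
        (Real.continuous_cos.comp (continuous_const.sub continuous_id))
  have hinv : ∀ g : AddSubgroup.zmultiples (2 * Real.pi), (fun x ↦ g +ᵥ x) ⁻¹' A = A := by
    rintro ⟨_, n, rfl⟩
    ext x
    have e : ∀ ψ : ℝ, Real.cos (ψ - ((n • (2 * Real.pi)) + x)) = Real.cos (ψ - x) := by
      intro ψ
      rw [show ψ - ((n • (2 * Real.pi)) + x) = ψ - x - n * (2 * Real.pi) by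
        rw [zsmul_eq_mul]; ring]
      exact Real.cos_sub_int_mul_two_pi _ _
    simp only [hA, mem_preimage, mem_ofPred_eq, AddSubgroup.vadd_def, vadd_eq_add, e]
  have : VAddInvariantMeasure (AddSubgroup.zmultiples (2 * Real.pi)) ℝ volume :=
    ⟨fun c s _ ↦ measure_preimage_add _ _ _⟩
  -- By periodicity the measure may be computed in the window centred at ψ₁, where the signs of the
  -- cosines are easily read off.
  have hper : volume (A ∩ Ioc (-Real.pi) (-Real.pi + 2 * Real.pi)) =
      volume (A ∩ Ioc (ψ₁ - Real.pi) (ψ₁ - Real.pi + 2 * Real.pi)) :=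
    (isAddFundamentalDomain_Ioc Real.two_pi_pos _).measure_set_eq
      (isAddFundamentalDomain_Ioc Real.two_pi_pos _) hAm hinv
  rw [show -Real.pi + 2 * Real.pi = Real.pi by ring] at hper
  rw [hper]
  -- The extra point is needed when ψ₂ - ψ₁ = π: the half-planes are then opposite and share a whole
  -- line, which contributes a second, isolated direction.
  have hsub : A ∩ Ioc (ψ₁ - Real.pi) (ψ₁ - Real.pi + 2 * Real.pi) ⊆
      Icc (ψ₂ - Real.pi / 2) (ψ₁ + Real.pi / 2) ∪ {ψ₁ - Real.pi / 2} := by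
    rintro θ ⟨⟨h1, h2⟩, h3, h4⟩
    have hle : θ ≤ ψ₁ + Real.pi / 2 := by
      by_contra! hlt
      have := Real.cos_neg_of_pi_div_two_lt_of_lt (x := θ - ψ₁) (by linarith) (by linarith)
      rw [← Real.cos_neg, neg_sub] at this
      linarith
    have hge : ψ₁ - Real.pi / 2 ≤ θ := by
      by_contra! hlt
      have := Real.cos_neg_of_pi_div_two_lt_of_lt (x := ψ₁ - θ) (by linarith)
        (by linarith [Real.pi_pos])
      linarith
    rcases hge.eq_or_lt with heq | hgt
    · exact Or.inr heq.symm
    refine Or.inl ⟨?_, hle⟩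
    by_contra! hlt
    have := Real.cos_neg_of_pi_div_two_lt_of_lt (x := ψ₂ - θ) (by linarith) (by linarith)
    linarith
  calc _ ≤ volume (Icc (ψ₂ - Real.pi / 2) (ψ₁ + Real.pi / 2)) + volume {ψ₁ - Real.pi / 2} :=
        (measure_mono hsub).trans (measure_union_le _ _)
    _ = _ := by rw [Real.volume_Icc, Real.volume_singleton, add_zero]; ring_nf

/-- If the opening angle of `Ω` at infinity is at most `πα`, then the directions in which the
complement of `Ω` is unbounded have measure at least `2π - πα`. -/
lemma two_pi_le_of_openingAngle_le {Ω : Set ℂ} {α : ℝ} (hα : 0 ≤ α)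
    (h : openingAngleAtInfinity Ω ≤ ENNReal.ofReal (Real.pi * α)) {A : Set ℝ} {m : ℝ} (hm : 0 ≤ m)
    (hA : ∀ θ : ℝ, (∃ᶠ t : ℝ in atTop, (t : ℂ) * Complex.exp (θ * Complex.I) ∈ Ωᶜ) → θ ∈ A)
    (hAm : volume (A ∩ Ioc (-Real.pi) Real.pi) ≤ ENNReal.ofReal m) :
    2 * Real.pi ≤ Real.pi * α + m := by
  have hsub : Ioc (-Real.pi) Real.pi ⊆ {θ : ℝ | θ ∈ Ioc (-Real.pi) Real.pi ∧
      ∀ᶠ t : ℝ in atTop, (t : ℂ) * Complex.exp (θ * Complex.I) ∈ Ω} ∪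
      (A ∩ Ioc (-Real.pi) Real.pi) := by
    intro θ hθ
    by_cases h1 : ∀ᶠ t : ℝ in atTop, (t : ℂ) * Complex.exp (θ * Complex.I) ∈ Ω
    · exact Or.inl ⟨hθ, h1⟩
    · exact Or.inr ⟨hA θ (not_eventually.1 h1), hθ⟩
  have h1 := (measure_mono (μ := volume) hsub).trans
    ((measure_union_le _ _).trans (add_le_add h hAm))
  rw [Real.volume_Ioc, ← ENNReal.ofReal_add (mul_nonneg Real.pi_pos.le hα) hm,
    ENNReal.ofReal_le_ofReal_iff (add_nonneg (mul_nonneg Real.pi_pos.le hα) hm)] at h1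
  linarith

end OpeningAngle

/-! ### The upper bound -/

section UpperBound

open Metric ComplexConjugate

variable {α : ℝ} {f : ℂ → ℂ}

lemma re_conj_exp_mul (θ : ℝ) (w : ℂ) :
    (conj (Complex.exp (θ * Complex.I)) * w).re = ‖w‖ * Real.cos (w.arg - θ) := by
  have h : conj (Complex.exp (θ * Complex.I)) * w =
      ‖w‖ * Complex.exp ((w.arg - θ : ℝ) * Complex.I) := by
    conv_lhs => rw [← Complex.norm_mul_exp_arg_mul_I w]
    rw [← Complex.exp_conj, map_mul, Complex.conj_ofReal, Complex.conj_I, mul_left_comm,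
      ← Complex.exp_add]
    push_cast
    ring_nf
  rw [h, Complex.re_ofReal_mul, Complex.exp_ofReal_mul_I_re]

namespace IsConcaveUnivalent

lemma isOpen_image (hf : IsConcaveUnivalent α f) : IsOpen (f '' ball 0 1) :=
  isOpen_image_of_injOn isOpen_ball hf.analytic hf.univalent

lemma deriv_ne_zero (hf : IsConcaveUnivalent α f) {z : ℂ} (hz : z ∈ ball (0 : ℂ) 1) :
    deriv f z ≠ 0 :=
  deriv_ne_zero_of_injOn isOpen_ball hf.analytic hf.univalent hz

lemma not_isBounded_compl (hf : IsConcaveUnivalent α f) :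
    ¬ Bornology.IsBounded (f '' ball 0 1)ᶜ :=
  not_isBounded_compl_image hf.analytic hf.univalent hf.tendsto_infinity

lemma compl_nonempty (hf : IsConcaveUnivalent α f) : (f '' ball 0 1)ᶜ.Nonempty := by
  by_contra h
  rw [not_nonempty_iff_eq_empty] at h
  exact hf.not_isBounded_compl (h ▸ Bornology.isBounded_empty)

lemma mono (hf : IsConcaveUnivalent α f) {α' : ℝ} (h : α ≤ α') : IsConcaveUnivalent α' f :=
  { hf with
    openingAngle_le := hf.openingAngle_le.trans
      (ENNReal.ofReal_le_ofReal (mul_le_mul_of_nonneg_left h Real.pi_pos.le)) }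

/-- For `f` in `Co(α)` and a suitable boundary point `τ`, the function `(τ - z) ^ 2 * f' z` takes
its values in a sector of opening angle `π * (α - 1)`. -/
theorem exists_sector (hf : IsConcaveUnivalent α f) (h1 : 1 ≤ α) :
    ∃ τ C : ℂ, ‖τ‖ = 1 ∧ C ≠ 0 ∧ (∀ z ∈ ball (0 : ℂ) 1, 0 ≤ (C * (τ - z) ^ 2 * deriv f z).re) ∧
      ∀ z ∈ ball (0 : ℂ) 1, ∀ w ∈ ball (0 : ℂ) 1,
        (C * (τ - z) ^ 2 * deriv f z).arg - (C * (τ - w) ^ 2 * deriv f w).arg ≤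
          Real.pi * (α - 1) := by
  have hKc : IsClosed (f '' ball 0 1)ᶜ := hf.isOpen_image.isClosed_compl
  obtain ⟨τ, hτ, hdual⟩ := exists_re_conj_mul_nonneg hf.analytic hf.univalent hf.map_zero
    hf.convex_compl hf.compl_nonempty
  obtain ⟨c, hc1, hc⟩ := exists_isRecessionDirection hKc hf.convex_compl hf.not_isBounded_compl
  have hc0 : c ≠ 0 := by rintro rfl; simp at hc1
  have hτ0 : τ ≠ 0 := by rintro rfl; simp at hτ
  have hcexp : Complex.exp (c.arg * Complex.I) = c := by
    have := Complex.norm_mul_exp_arg_mul_I c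
    rwa [hc1, Complex.ofReal_one, one_mul] at this
  -- Rotating by one fixed recession direction c puts all values in the closed right half-plane, so
  -- their arguments can be compared without wrapping around.
  set C : ℂ := conj c * -conj τ with hC
  have hC0 : C ≠ 0 := mul_ne_zero (by simpa using hc0) (by simpa using hτ0)
  have hCre : ∀ z ∈ ball (0 : ℂ) 1, 0 ≤ (C * (τ - z) ^ 2 * deriv f z).re := by
    intro z hz
    have := hdual c hc z hz
    rwa [← mul_assoc, ← mul_assoc] at this
  refine ⟨τ, C, hτ, hC0, hCre, fun z hz w hw ↦ ?_⟩
  have hne : ∀ z ∈ ball (0 : ℂ) 1, C * (τ - z) ^ 2 * deriv f z ≠ 0 := by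
    intro z hz
    refine mul_ne_zero (mul_ne_zero hC0 (pow_ne_zero 2 fun h ↦ ?_)) (hf.deriv_ne_zero hz)
    rw [sub_eq_zero] at h
    rw [mem_ball_zero_iff, ← h, hτ] at hz
    exact lt_irrefl _ hz
  have hcos : ∀ θ : ℝ, (∃ᶠ t : ℝ in atTop, (t : ℂ) * Complex.exp (θ * Complex.I) ∈
      (f '' ball 0 1)ᶜ) → ∀ z ∈ ball (0 : ℂ) 1,
      0 ≤ Real.cos ((C * (τ - z) ^ 2 * deriv f z).arg + c.arg - θ) := by
    intro θ hθ z hz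
    have h2 := hdual _ (isRecessionDirection_exp hKc hf.convex_compl hθ) z hz
    have hcc : c * conj c = 1 := by
      rw [Complex.mul_conj, Complex.normSq_eq_norm_sq, hc1]; simp
    have e : conj (Complex.exp (θ * Complex.I)) * (-conj τ * (τ - z) ^ 2 * deriv f z) =
        conj (Complex.exp ((θ - c.arg : ℝ) * Complex.I)) * (C * (τ - z) ^ 2 * deriv f z) := by
      have : Complex.exp (θ * Complex.I) = Complex.exp ((θ - c.arg : ℝ) * Complex.I) * c := by
        conv_rhs => rw [← hcexp]
        rw [← Complex.exp_add]
        simp only [hcexp]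
        push_cast
        ring_nf
      rw [this, map_mul, hC]
      ring
    rw [e, re_conj_exp_mul] at h2
    have h3 := nonneg_of_mul_nonneg_right h2 (norm_pos_iff.2 (hne z hz))
    rwa [sub_sub_eq_add_sub] at h3
  set ψz := (C * (τ - z) ^ 2 * deriv f z).arg with hψz
  set ψw := (C * (τ - w) ^ 2 * deriv f w).arg with hψw
  have hz1 := abs_le.1 (Complex.abs_arg_le_pi_div_two_iff.2 (hCre z hz))
  have hw1 := abs_le.1 (Complex.abs_arg_le_pi_div_two_iff.2 (hCre w hw))
  rcases le_total ψz ψw with hle | hle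
  · have : 0 ≤ Real.pi * (α - 1) := mul_nonneg Real.pi_pos.le (by linarith)
    linarith
  have hπ : ψz - ψw ≤ Real.pi := by linarith [hz1.2, hw1.1]
  -- Two values at angle δ = ψz - ψw confine the recession directions to a sector of angle π - δ.
  -- Hence 2π ≤ πα + π - δ, that is δ ≤ π(α - 1).
  have hvol := volume_cos_nonneg_inter_le (ψ₁ := ψw + c.arg) (ψ₂ := ψz + c.arg) (by linarith)
  have := two_pi_le_of_openingAngle_le (by linarith) hf.openingAngle_le
    (A := {θ : ℝ | 0 ≤ Real.cos (ψw + c.arg - θ) ∧ 0 ≤ Real.cos (ψz + c.arg - θ)})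
    (by linarith) (fun θ hθ ↦ ⟨hcos θ hθ w hw, hcos θ hθ z hz⟩) hvol
  linarith

/-- The logarithmic derivative of (τ - z)² f' is T_f - 2/(τ - z). The sector estimate with κ = α - 1
> 0 bounds it, and |τ - z| ≥ 1 - |z| gives (1 - |z|²)·2/|τ - z| ≤ 2(1 + |z|) ≤ 4. -/
lemma norm_preSchwarzian_le_of_one_lt (hf : IsConcaveUnivalent α f) (h1 : 1 < α) {z : ℂ}
    (hz : ‖z‖ < 1) : (1 - ‖z‖ ^ 2) * ‖preSchwarzian f z‖ ≤ 2 * α + 2 := by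
  obtain ⟨τ, C, hτ, hC, hre, harg⟩ := hf.exists_sector h1.le
  have hne : ∀ z ∈ ball (0 : ℂ) 1, τ - z ≠ 0 := by
    intro z hz h
    rw [sub_eq_zero] at h
    rw [mem_ball_zero_iff, ← h, hτ] at hz
    exact lt_irrefl _ hz
  have hf'd : DifferentiableOn ℂ (deriv f) (ball 0 1) := hf.analytic.deriv isOpen_ball
  have hzb : z ∈ ball (0 : ℂ) 1 := mem_ball_zero_iff.2 hz
  have hk : ∀ w ∈ ball (0 : ℂ) 1, HasDerivAt (fun w ↦ C * (τ - w) ^ 2 * deriv f w)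
      (C * (2 * (τ - w) * (-1)) * deriv f w + C * (τ - w) ^ 2 * deriv (deriv f) w) w := by
    intro w hw
    have h2 := (hf'd.differentiableAt (isOpen_ball.mem_nhds hw)).hasDerivAt
    have h3 : HasDerivAt (fun w : ℂ ↦ (τ - w) ^ 2) (2 * (τ - w) * (-1)) w := by
      have := ((hasDerivAt_id w).const_sub τ).pow 2
      simpa [Pi.pow_def] using this
    exact (h3.const_mul C).mul h2
  have hb := norm_logDeriv_le_of_arg_sub_arg_le (sub_pos.2 h1)
    (fun w hw ↦ (hk w hw).differentiableAt.differentiableWithinAt)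
    (fun w hw ↦ mul_ne_zero (mul_ne_zero hC (pow_ne_zero 2 (hne w hw))) (hf.deriv_ne_zero hw))
    hre harg hz
  rw [(hk z hzb).deriv] at hb
  have hz0 := hne z hzb
  have hd0 := hf.deriv_ne_zero hzb
  set Q := (C * (2 * (τ - z) * (-1)) * deriv f z + C * (τ - z) ^ 2 * deriv (deriv f) z) /
    (C * (τ - z) ^ 2 * deriv f z) with hQ
  have e : preSchwarzian f z = Q + 2 / (τ - z) := by
    rw [hQ, preSchwarzian]
    field_simp
    ring
  have hpos : 0 < ‖τ - z‖ := norm_pos_iff.2 hz0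
  have hge : 1 - ‖z‖ ≤ ‖τ - z‖ := by
    rw [← hτ]; exact norm_sub_norm_le _ _
  have h4 : (1 - ‖z‖ ^ 2) * ‖2 / (τ - z)‖ ≤ 4 := by
    rw [norm_div, Complex.norm_ofNat, mul_div_assoc', div_le_iff₀ hpos]
    nlinarith [norm_nonneg z]
  have h5 : 0 ≤ 1 - ‖z‖ ^ 2 := (one_sub_norm_sq_pos hz).le
  calc (1 - ‖z‖ ^ 2) * ‖preSchwarzian f z‖
      ≤ (1 - ‖z‖ ^ 2) * (‖Q‖ + ‖2 / (τ - z)‖) := by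
        rw [e]
        exact mul_le_mul_of_nonneg_left (norm_add_le _ _) h5
    _ ≤ 2 * (α - 1) + 4 := by rw [mul_add]; exact add_le_add hb h4
    _ = 2 * α + 2 := by ring

/-- The upper bound for the pre-Schwarzian norm in `Co(α)`. -/
theorem preSchwarzianNorm_le (hf : IsConcaveUnivalent α f) (h1 : 1 ≤ α) :
    preSchwarzianNorm f ≤ ENNReal.ofReal (2 * α + 2) := by
  refine iSup₂_le fun z hz ↦ ENNReal.ofReal_le_ofReal ?_
  -- Enlarging α by ε/2 covers α = 1, where the sector degenerates to a ray and no root can be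
  -- taken.
  refine le_of_forall_pos_le_add fun ε hε ↦ ?_
  have := (hf.mono (show α ≤ α + ε / 2 by linarith)).norm_preSchwarzian_le_of_one_lt
    (by linarith) (mem_ball_zero_iff.1 hz)
  linarith

end IsConcaveUnivalent

end UpperBound

/-! ### The lower bound -/

section LowerBound

open Metric ComplexConjugate

variable {α : ℝ} {f : ℂ → ℂ}

lemma one_sub_ne_zero_of_mem_ball {z : ℂ} (hz : z ∈ ball (0 : ℂ) 1) : 1 - z ≠ 0 := by
  intro h
  rw [sub_eq_zero] at h
  rw [← h, mem_ball_zero_iff, norm_one] at hz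
  exact lt_irrefl _ hz

lemma neg_half_lt_re_div_one_sub {z : ℂ} (hz : z ∈ ball (0 : ℂ) 1) :
    -1 / 2 < (z / (1 - z)).re := by
  have h1 := one_sub_norm_sq_pos (mem_ball_zero_iff.1 hz)
  have h2 : 0 < Complex.normSq (1 - z) := Complex.normSq_pos.2 (one_sub_ne_zero_of_mem_ball hz)
  rw [Complex.div_re, ← add_div, lt_div_iff₀ h2]
  rw [Complex.sq_norm] at h1
  simp only [Complex.normSq_apply, Complex.sub_re, Complex.sub_im, Complex.one_re,
    Complex.one_im] at h1 ⊢
  nlinarith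

namespace IsConcaveUnivalent

/-- A bound for the pre-Schwarzian derivative bounds the growth of the derivative. -/
lemma norm_deriv_le_rpow (hf : IsConcaveUnivalent α f) {M p : ℝ} (hMp : M < 2 * p)
    (hM : ∀ z ∈ ball (0 : ℂ) 1, (1 - ‖z‖ ^ 2) * ‖preSchwarzian f z‖ ≤ M) {u : ℂ} (hu : ‖u‖ = 1)
    {ρ : ℝ} (hρ0 : 0 ≤ ρ) (hρ1 : ρ < 1) : ‖deriv f (ρ * u)‖ ≤ ((1 + ρ) / (1 - ρ)) ^ p := by
  have hmem : ∀ x : ℝ, 0 ≤ x → x ≤ ρ → (x : ℂ) * u ∈ ball (0 : ℂ) 1 := by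
    intro x h0 h1
    rw [mem_ball_zero_iff, norm_mul, hu, mul_one, Complex.norm_real, Real.norm_eq_abs,
      abs_of_nonneg h0]
    linarith
  have hf'd : DifferentiableOn ℂ (deriv f) (ball 0 1) := hf.analytic.deriv isOpen_ball
  have hpath : ∀ x ∈ Icc 0 ρ, HasDerivAt (fun x : ℝ ↦ deriv f (x * u))
      (deriv (deriv f) (x * u) * (1 * u)) x := by
    intro x hx
    have h1 : HasDerivAt (fun x : ℝ ↦ (x : ℂ) * u) (1 * u) x :=
      (Complex.ofRealCLM.hasDerivAt (x := x)).mul_const u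
    have h2 := (hf'd.differentiableAt (isOpen_ball.mem_nhds (hmem x hx.1 hx.2))).hasDerivAt
    exact HasDerivAt.comp (h := fun x : ℝ ↦ (x : ℂ) * u) x h2 h1
  -- B solves B' = 2p B / (1 - x²) with B(0) = 1. Where |f'| = B, the bound on T_f gives |f''| ≤ M B
  -- / (1 - x²) < B', so |f'| never overtakes B.
  set B : ℝ → ℝ := fun x ↦ Real.exp (p * (Real.log (1 + x) - Real.log (1 - x))) with hB
  have hBd : ∀ x ∈ Icc 0 ρ, HasDerivAt B (B x * (p * (1 / (1 + x) - (-1) / (1 - x)))) x := by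
    intro x hx
    have h1 : HasDerivAt (fun x : ℝ ↦ Real.log (1 + x)) (1 / (1 + x)) x :=
      ((hasDerivAt_id x).const_add 1).log (by simp only [id]; linarith [hx.1])
    have h2 : HasDerivAt (fun x : ℝ ↦ Real.log (1 - x)) ((-1) / (1 - x)) x :=
      ((hasDerivAt_id x).const_sub 1).log (by simp only [id]; linarith [hx.2])
    exact ((h1.sub h2).const_mul p).exp
  have key := image_norm_le_of_norm_deriv_right_lt_deriv_boundary' (a := 0) (b := ρ)
    (f := fun x : ℝ ↦ deriv f (x * u)) (B := B)
    (fun x hx ↦ (hpath x hx).continuousAt.continuousWithinAt)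
    (fun x hx ↦ (hpath x (Ico_subset_Icc_self hx)).hasDerivWithinAt)
    (by simp [hB, hf.deriv_zero])
    (fun x hx ↦ (hBd x hx).continuousAt.continuousWithinAt)
    (fun x hx ↦ (hBd x (Ico_subset_Icc_self hx)).hasDerivWithinAt)
    (by
      intro x hx heq
      have hx1 : 0 < 1 - x := by linarith [hx.2]
      have hx2 : 0 < 1 + x := by linarith [hx.1]
      have hxm := hmem x hx.1 hx.2.le
      have h1 := hM _ hxm
      have hn : ‖(x : ℂ) * u‖ = x := by
        rw [norm_mul, hu, mul_one, Complex.norm_real, Real.norm_eq_abs, abs_of_nonneg hx.1]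
      rw [hn, preSchwarzian, norm_div, heq] at h1
      have hBx : 0 < B x := Real.exp_pos _
      rw [one_mul, norm_mul, hu, mul_one]
      have h2 : (1 - x ^ 2) * ‖deriv (deriv f) (x * u)‖ ≤ M * B x := by
        rwa [mul_div_assoc', div_le_iff₀ hBx] at h1
      have h3 : B x * (p * (1 / (1 + x) - (-1) / (1 - x))) = 2 * p * B x / (1 - x ^ 2) := by
        have : 1 - x ^ 2 = (1 - x) * (1 + x) := by ring
        rw [this]
        field_simp
        ring
      have h4 : 0 < 1 - x ^ 2 := by nlinarith
      rw [h3, lt_div_iff₀ h4]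
      nlinarith)
  have h := key ⟨hρ0, le_rfl⟩
  have h1 : 0 < 1 - ρ := by linarith
  have h2 : 0 < 1 + ρ := by linarith
  rw [Real.rpow_def_of_pos (by positivity), Real.log_div h2.ne' h1.ne', mul_comm _ p]
  exact h

/-- A bound for the pre-Schwarzian derivative bounds the growth of the function. -/
lemma norm_le_rpow (hf : IsConcaveUnivalent α f) {M p : ℝ} (hMp : M < 2 * p) (hp : 1 < p)
    (hM : ∀ z ∈ ball (0 : ℂ) 1, (1 - ‖z‖ ^ 2) * ‖preSchwarzian f z‖ ≤ M) {z : ℂ} (hz : ‖z‖ < 1) :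
    ‖f z‖ ≤ 2 ^ p / (p - 1) * (1 - ‖z‖) ^ (1 - p) := by
  set ρ := ‖z‖ with hρ
  set u := Complex.exp (z.arg * Complex.I) with hudef
  have hu : ‖u‖ = 1 := Complex.norm_exp_ofReal_mul_I _
  have hzu : (ρ : ℂ) * u = z := Complex.norm_mul_exp_arg_mul_I z
  have hρ0 : 0 ≤ ρ := norm_nonneg z
  have hpath : ∀ x ∈ Icc 0 ρ, HasDerivAt (fun x : ℝ ↦ f (x * u)) (deriv f (x * u) * (1 * u)) x := by
    intro x hx
    have h1 : HasDerivAt (fun x : ℝ ↦ (x : ℂ) * u) (1 * u) x :=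
      (Complex.ofRealCLM.hasDerivAt (x := x)).mul_const u
    have hmem : (x : ℂ) * u ∈ ball (0 : ℂ) 1 := by
      rw [mem_ball_zero_iff, norm_mul, hu, mul_one, Complex.norm_real, Real.norm_eq_abs,
        abs_of_nonneg hx.1]
      linarith [hx.2]
    have h2 := (hf.analytic.differentiableAt (isOpen_ball.mem_nhds hmem)).hasDerivAt
    exact HasDerivAt.comp (h := fun x : ℝ ↦ (x : ℂ) * u) x h2 h1
  -- An antiderivative of (2 / (1 - x))^p, which dominates |f'| along the radius.
  set B : ℝ → ℝ := fun x ↦ 2 ^ p / (p - 1) * (1 - x) ^ (1 - p) with hB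
  have hBd : ∀ x ∈ Icc 0 ρ, HasDerivAt B
      (2 ^ p / (p - 1) * (-1 * (1 - p) * (1 - x) ^ (1 - p - 1))) x := by
    intro x hx
    exact (((hasDerivAt_id x).const_sub 1).rpow_const
      (Or.inl (by simp only [id]; linarith [hx.2]))).const_mul _
  have hp1 : 0 < p - 1 := by linarith
  have key := image_norm_le_of_norm_deriv_right_le_deriv_boundary' (a := 0) (b := ρ)
    (f := fun x : ℝ ↦ f (x * u)) (B := B)
    (fun x hx ↦ (hpath x hx).continuousAt.continuousWithinAt)
    (fun x hx ↦ (hpath x (Ico_subset_Icc_self hx)).hasDerivWithinAt)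
    (by
      simp only [Complex.ofReal_zero, zero_mul, hf.map_zero, norm_zero, hB]
      positivity)
    (fun x hx ↦ (hBd x hx).continuousAt.continuousWithinAt)
    (fun x hx ↦ (hBd x (Ico_subset_Icc_self hx)).hasDerivWithinAt)
    (by
      intro x hx
      have hx1 : 0 < 1 - x := by linarith [hx.2]
      have hx2 : 0 < 1 + x := by linarith [hx.1]
      rw [one_mul, norm_mul, hu, mul_one]
      have h1 := hf.norm_deriv_le_rpow hMp hM hu hx.1 (hx.2.trans hz)
      have h2 : ((1 + x) / (1 - x)) ^ p ≤ (2 / (1 - x)) ^ p := by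
        refine Real.rpow_le_rpow (by positivity) ?_ (by linarith)
        gcongr
        linarith [hx.2]
      have h3 : (2 / (1 - x)) ^ p =
          2 ^ p / (p - 1) * (-1 * (1 - p) * (1 - x) ^ (1 - p - 1)) := by
        rw [Real.div_rpow (by norm_num) hx1.le, show 1 - p - 1 = -p by ring,
          Real.rpow_neg hx1.le]
        field_simp
        ring
      rw [← h3]
      exact h1.trans h2)
  have h := key ⟨hρ0, le_rfl⟩
  simp only [hzu] at h
  exact h

/-- The lower bound for the pre-Schwarzian norm in `Co(α)`. -/
theorem four_le_preSchwarzianNorm (hf : IsConcaveUnivalent α f) : 4 ≤ preSchwarzianNorm f := by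
  by_contra! hlt
  have hfin : preSchwarzianNorm f ≠ ⊤ := (hlt.trans (by simp)).ne
  set M := (preSchwarzianNorm f).toReal with hMdef
  have hM4 : M < 4 := by
    have := (ENNReal.toReal_lt_toReal hfin (by simp)).2 hlt
    simpa using this
  have hM0 : 0 ≤ M := ENNReal.toReal_nonneg
  have hM : ∀ z ∈ ball (0 : ℂ) 1, (1 - ‖z‖ ^ 2) * ‖preSchwarzian f z‖ ≤ M := by
    intro z hz
    have h1 : ENNReal.ofReal ((1 - ‖z‖ ^ 2) * ‖preSchwarzian f z‖) ≤ preSchwarzianNorm f :=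
      le_iSup₂ (f := fun z (_ : z ∈ ball (0 : ℂ) 1) ↦
        ENNReal.ofReal ((1 - ‖z‖ ^ 2) * ‖preSchwarzian f z‖)) z hz
    exact (ENNReal.ofReal_le_iff_le_toReal hfin).1 h1
  -- Any exponent with max(M/2, 1) < p < 2 would do; one exists because M < 4.
  set p := M / 8 + 3 / 2 with hp
  have hMp : M < 2 * p := by linarith
  have hp1 : 1 < p := by linarith
  have hp2 : p < 2 := by linarith
  have h0Ω : (0 : ℂ) ∉ (f '' ball 0 1)ᶜ := fun h ↦ h ⟨0, mem_ball_self one_pos, hf.map_zero⟩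
  obtain ⟨n, s, hn, hs, hH⟩ := exists_halfPlane_subset_compl hf.isOpen_image.isClosed_compl
    hf.convex_compl hf.compl_nonempty h0Ω
  rw [compl_compl] at hH
  have hnn : conj n * n = 1 := by
    rw [mul_comm, Complex.mul_conj, Complex.normSq_eq_norm_sq, hn]; simp
  set g := Function.invFunOn f (ball 0 1) with hg
  -- The conformal map of the disk onto the half-plane Re(conj n · w) < s fixing 0. Since Ω contains
  -- this half-plane, g ∘ L is a self-map of the disk fixing 0, and |g(L r)| ≤ r.
  set L : ℂ → ℂ := fun ζ ↦ -(2 * s : ℝ) * n * (ζ / (1 - ζ)) with hL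
  have hLd : DifferentiableOn ℂ L (ball 0 1) := by
    intro ζ hζ
    have := one_sub_ne_zero_of_mem_ball hζ
    simp only [hL]
    fun_prop (disch := assumption)
  have hLm : MapsTo L (ball 0 1) (f '' ball 0 1) := by
    intro ζ hζ
    apply hH
    have e : conj n * L ζ = (-(2 * s) : ℝ) * (ζ / (1 - ζ)) := by
      simp only [hL]
      push_cast
      linear_combination (-(2 * (s : ℂ)) * (ζ / (1 - ζ))) * hnn
    rw [e, Complex.re_ofReal_mul]
    nlinarith [neg_half_lt_re_div_one_sub hζ]
  have hωd : DifferentiableOn ℂ (fun ζ ↦ g (L ζ)) (ball 0 1) :=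
    (differentiableOn_invFunOn isOpen_ball hf.analytic hf.univalent).comp hLd hLm
  have hωm : MapsTo (fun ζ ↦ g (L ζ)) (ball 0 1) (ball 0 1) := fun ζ hζ ↦
    Function.invFunOn_mem (hLm hζ)
  have hω0 : g (L 0) = 0 := by
    have : L 0 = f 0 := by simp [hL, hf.map_zero]
    rw [this]
    exact hf.univalent.leftInvOn_invFunOn (mem_ball_self one_pos)
  -- Here |L r| = 2sr/(1 - r) is set against the growth bound for f at g(L r). As 2 - p > 0, letting
  -- r → 1 gives 2s ≤ 0, which is absurd.
  have hineq : ∀ r ∈ Ioo (0 : ℝ) 1, 2 * s * r ≤ 2 ^ p / (p - 1) * (1 - r) ^ (2 - p) := by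
    intro r hr
    have hr1 : 0 < 1 - r := by linarith [hr.2]
    have hrn : ‖(r : ℂ)‖ = r := by rw [Complex.norm_real, Real.norm_eq_abs, abs_of_pos hr.1]
    have hrb : (r : ℂ) ∈ ball (0 : ℂ) 1 := by rw [mem_ball_zero_iff, hrn]; exact hr.2
    have h1 : ‖g (L r)‖ ≤ r := by
      have := Complex.norm_le_norm_of_mapsTo_ball hωd (hωm.mono_right ball_subset_closedBall) hω0
        (mem_ball_zero_iff.1 hrb)
      rwa [hrn] at this
    have h2 := hf.norm_le_rpow hMp hp1 hM (h1.trans_lt hr.2)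
    rw [Function.invFunOn_eq (hLm hrb)] at h2
    have h3 : ‖L r‖ = 2 * s * r / (1 - r) := by
      have e : (1 : ℂ) - r = ((1 - r : ℝ) : ℂ) := by push_cast; ring
      rw [hL]
      simp only
      rw [norm_mul, norm_mul, norm_neg, hn, mul_one, norm_div, hrn, e, Complex.norm_real,
        Complex.norm_real, Real.norm_eq_abs, Real.norm_eq_abs, abs_of_pos hr1,
        abs_of_pos (by linarith), mul_div_assoc]
    rw [h3] at h2
    have h4 : (1 - ‖g (L r)‖) ^ (1 - p) ≤ (1 - r) ^ (1 - p) :=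
      Real.rpow_le_rpow_of_nonpos hr1 (by linarith) (by linarith)
    have h5 : 0 < (2 : ℝ) ^ p / (p - 1) := div_pos (by positivity) (by linarith)
    have h6 := h2.trans (mul_le_mul_of_nonneg_left h4 h5.le)
    rw [div_le_iff₀ hr1] at h6
    rwa [show 2 - p = 1 - p + 1 by ring, Real.rpow_add_one hr1.ne', ← mul_assoc]
  have hlim1 : Tendsto (fun r : ℝ ↦ 2 * s * r) (𝓝[<] 1) (𝓝 (2 * s * 1)) :=
    (tendsto_id.mono_left nhdsWithin_le_nhds).const_mul _
  have hlim2 : Tendsto (fun r : ℝ ↦ 2 ^ p / (p - 1) * (1 - r) ^ (2 - p)) (𝓝[<] 1)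
      (𝓝 (2 ^ p / (p - 1) * (1 - 1) ^ (2 - p))) := by
    have h1 : Tendsto (fun r : ℝ ↦ 1 - r) (𝓝[<] 1) (𝓝 (1 - 1)) :=
      (tendsto_id.mono_left nhdsWithin_le_nhds).const_sub _
    exact (h1.rpow_const (Or.inr (by linarith))).const_mul _
  have := le_of_tendsto_of_tendsto hlim1 hlim2 (by
    filter_upwards [Ioo_mem_nhdsLT (zero_lt_one' ℝ)] with r hr using hineq r hr)
  rw [sub_self, Real.zero_rpow (by linarith)] at this
  linarith

end IsConcaveUnivalent

end LowerBound

/-! ### The extremal function for the lower bound -/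

section HalfPlaneMap

open Metric

lemma tendsto_norm_inv_one_sub :
    Tendsto (fun z : ℂ ↦ ‖(1 - z)⁻¹‖) (𝓝[ball 0 1] 1) atTop := by
  have h1 : Tendsto (fun z : ℂ ↦ 1 - z) (𝓝[ball 0 1] 1) (𝓝[≠] 0) := by
    refine tendsto_nhdsWithin_iff.2 ⟨?_, ?_⟩
    · have : Tendsto (fun z : ℂ ↦ 1 - z) (𝓝 1) (𝓝 (1 - 1)) := tendsto_id.const_sub 1
      rw [sub_self] at this
      exact this.mono_left nhdsWithin_le_nhds
    · filter_upwards [self_mem_nhdsWithin] with z hz using one_sub_ne_zero_of_mem_ball hz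
  exact tendsto_norm_cobounded_atTop.comp ((tendsto_inv₀_nhdsNE_zero (α := ℂ)).comp h1)

lemma hasDerivAt_gPi {z : ℂ} (hz : z ∈ ball (0 : ℂ) 1) : HasDerivAt gPi (1 / (1 - z) ^ 2) z := by
  have : HasDerivAt gPi ((1 * (1 - z) - z * (-1)) / (1 - z) ^ 2) z :=
    (hasDerivAt_id z).div ((hasDerivAt_id z).const_sub 1) (one_sub_ne_zero_of_mem_ball hz)
  convert this using 1
  ring

lemma gPi_image : gPi '' ball 0 1 = {w : ℂ | -1 / 2 < w.re} := by
  ext w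
  constructor
  · rintro ⟨z, hz, rfl⟩
    exact neg_half_lt_re_div_one_sub hz
  · intro hw
    rw [mem_ofPred_eq] at hw
    have h1 : 1 + w ≠ 0 := by
      intro h
      have := congrArg Complex.re h
      simp at this
      linarith
    refine ⟨w / (1 + w), ?_, ?_⟩
    · have h2 : 0 < ‖1 + w‖ := norm_pos_iff.2 h1
      rw [mem_ball_zero_iff, norm_div, div_lt_one h2]
      refine lt_of_pow_lt_pow_left₀ 2 h2.le ?_
      simp only [Complex.sq_norm, Complex.normSq_apply, Complex.add_re, Complex.add_im,
        Complex.one_re, Complex.one_im]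
      nlinarith
    · rw [gPi]
      have : 1 - w / (1 + w) = 1 / (1 + w) := by field_simp; ring
      rw [this]
      field_simp

lemma gPi_injOn : InjOn gPi (ball 0 1) := by
  intro z hz w hw h
  have h1 := one_sub_ne_zero_of_mem_ball hz
  have h2 := one_sub_ne_zero_of_mem_ball hw
  rw [gPi, gPi, div_eq_div_iff h1 h2] at h
  linear_combination h

/-- The parameter 1 is the sharp one: membership for larger α follows by `mono`, and the upper bound
at α = 1 is exactly 4. -/
theorem isConcaveUnivalent_gPi : IsConcaveUnivalent 1 gPi where
  analytic z hz := (hasDerivAt_gPi hz).differentiableAt.differentiableWithinAt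
  map_zero := by simp [gPi]
  deriv_zero := by simpa using (hasDerivAt_gPi (mem_ball_self one_pos)).deriv
  tendsto_infinity := by
    rw [← tendsto_norm_atTop_iff_cobounded]
    refine tendsto_atTop_mono' _ ?_ (tendsto_atTop_add_const_right _ (-1) tendsto_norm_inv_one_sub)
    filter_upwards [self_mem_nhdsWithin] with z hz
    have h1 := one_sub_ne_zero_of_mem_ball hz
    have e : gPi z = (1 - z)⁻¹ - 1 := by rw [gPi]; field_simp; ring
    have := norm_sub_norm_le (1 - z)⁻¹ (1 : ℂ)
    rw [norm_one] at this
    rw [e]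
    linarith
  univalent := gPi_injOn
  convex_compl := by
    have : (gPi '' ball 0 1)ᶜ = {w : ℂ | w.re ≤ -1 / 2} := by
      rw [gPi_image]
      ext w
      simp only [mem_compl_iff, mem_ofPred_eq, not_lt]
    rw [this]
    exact convex_halfSpace_re_le _
  openingAngle_le := by
    have hsub : {θ : ℝ | θ ∈ Ioc (-Real.pi) Real.pi ∧
        ∀ᶠ t : ℝ in atTop, (t : ℂ) * Complex.exp (θ * Complex.I) ∈ gPi '' ball 0 1} ⊆
        Icc (-(Real.pi / 2)) (Real.pi / 2) := by
      rintro θ ⟨hθ, ht⟩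
      have hcos : 0 ≤ Real.cos θ := by
        by_contra! hneg
        have h1 : Tendsto (fun t : ℝ ↦ t * Real.cos θ) atTop atBot :=
          tendsto_id.atTop_mul_const_of_neg hneg
        obtain ⟨t, h2, h3⟩ := (ht.and (h1.eventually_lt_atBot (-1 / 2))).exists
        rw [gPi_image, mem_ofPred_eq, Complex.re_ofReal_mul, Complex.exp_ofReal_mul_I_re] at h2
        linarith
      rw [mem_Icc, ← abs_le]
      by_contra! hlt
      have := Real.cos_neg_of_pi_div_two_lt_of_lt hlt
        (by linarith [abs_le.2 ⟨hθ.1.le, hθ.2⟩, Real.pi_pos])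
      rw [Real.cos_abs] at this
      linarith
    refine (measure_mono hsub).trans ?_
    rw [Real.volume_Icc]
    exact ENNReal.ofReal_le_ofReal (by linarith)

end HalfPlaneMap

/-! ### The extremal function for the upper bound -/

section SectorMap

open Metric ComplexConjugate

variable {α : ℝ}

/-- A sector of opening πα ≥ π is the union of the open half-planes it contains with 0 on their
boundary. Its complement is therefore an intersection of closed half-planes, which is how convexity
is obtained. -/
lemma exists_re_pos_iff_abs_arg_lt (hα : α ∈ Icc (1 : ℝ) 2) {v : ℂ} :
    (∃ ψ : ℝ, |ψ| ≤ Real.pi * (α - 1) / 2 ∧ 0 < (conj (Complex.exp (ψ * Complex.I)) * v).re) ↔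
      v ≠ 0 ∧ |v.arg| < Real.pi * α / 2 := by
  have hπ := Real.pi_pos
  obtain ⟨h1, h2⟩ := hα
  simp only [re_conj_exp_mul]
  constructor
  · rintro ⟨ψ, hψ, hpos⟩
    have hv : v ≠ 0 := by rintro rfl; simp at hpos
    refine ⟨hv, ?_⟩
    have hcos : 0 < Real.cos |v.arg - ψ| := by
      rw [Real.cos_abs]
      exact pos_of_mul_pos_right hpos (norm_nonneg v)
    have h3 : |v.arg - ψ| ≤ Real.pi + Real.pi / 2 := by
      refine (abs_sub _ _).trans (add_le_add (Complex.abs_arg_le_pi v) (hψ.trans ?_))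
      nlinarith
    have h4 : |v.arg - ψ| < Real.pi / 2 := by
      by_contra! hge
      linarith [Real.cos_nonpos_of_pi_div_two_le_of_le hge h3]
    have h5 := abs_sub_abs_le_abs_sub v.arg ψ
    linarith
  · rintro ⟨hv, harg⟩
    -- With this ψ, arg v - ψ = arg v / α, which lies within π/2 of 0.
    refine ⟨v.arg * ((α - 1) / α), ?_, ?_⟩
    · rw [abs_mul, abs_of_nonneg (div_nonneg (sub_nonneg.2 h1) (zero_le_one.trans h1)), mul_div_assoc',
        div_le_iff₀ (by linarith)]
      nlinarith
    · refine mul_pos (norm_pos_iff.2 hv) (Real.cos_pos_of_mem_Ioo ?_)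
      have : v.arg - v.arg * ((α - 1) / α) = v.arg / α := by
        field_simp
        ring
      rw [this, mem_Ioo, ← abs_lt, abs_div, abs_of_pos (show 0 < α by linarith),
        div_lt_iff₀ (by linarith)]
      linarith

/-- Since |arg q| < π/2 and α ≤ 2, α arg q stays strictly inside (-π, π), so no branch jump occurs.
-/
lemma log_cpow_of_re_pos (hα : α ∈ Icc (1 : ℝ) 2) {q : ℂ} (hq : 0 < q.re) :
    Complex.log (q ^ (α : ℂ)) = Complex.log q * α := by
  have hπ := Real.pi_pos
  have hq0 : q ≠ 0 := by rintro rfl; simp at hq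
  have harg := abs_lt.1 (Complex.abs_arg_lt_pi_div_two_iff.2 (Or.inl hq))
  have him : (Complex.log q * α).im = q.arg * α := by
    rw [Complex.im_mul_ofReal, Complex.log_im]
  rw [Complex.cpow_def_of_ne_zero hq0, Complex.log_exp]
  · rw [him]
    nlinarith [hα.1, hα.2]
  · rw [him]
    nlinarith [hα.1, hα.2]

lemma one_add_div_one_sub_re_pos {z : ℂ} (hz : z ∈ ball (0 : ℂ) 1) :
    0 < ((1 + z) / (1 - z)).re := by
  have h1 := one_sub_ne_zero_of_mem_ball hz
  have e : (1 + z) / (1 - z) = 1 + (2 : ℝ) * (z / (1 - z)) := by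
    push_cast
    field_simp
    ring
  rw [e, Complex.add_re, Complex.one_re, Complex.re_ofReal_mul]
  linarith [neg_half_lt_re_div_one_sub hz]

lemma ne_zero_of_re_pos {q : ℂ} (hq : 0 < q.re) : q ≠ 0 := by
  rintro rfl
  simp at hq

lemma two_mul_gZero_add_one (hα : 0 < α) (z : ℂ) :
    2 * α * gZero α z + 1 = ((1 + z) / (1 - z)) ^ (α : ℂ) := by
  have : (α : ℂ) ≠ 0 := by exact_mod_cast hα.ne'
  rw [gZero]
  field_simp
  ring

lemma mem_gZero_image_iff (hα : α ∈ Icc (1 : ℝ) 2) {w : ℂ} :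
    w ∈ gZero α '' ball 0 1 ↔
      2 * α * w + 1 ≠ 0 ∧ |(2 * α * w + 1 : ℂ).arg| < Real.pi * α / 2 := by
  have hπ := Real.pi_pos
  have hα0 : 0 < α := by linarith [hα.1]
  have hαc : (α : ℂ) ≠ 0 := by exact_mod_cast hα0.ne'
  constructor
  · rintro ⟨z, hz, rfl⟩
    have hq := one_add_div_one_sub_re_pos hz
    rw [two_mul_gZero_add_one hα0]
    refine ⟨by simp [Complex.cpow_eq_zero_iff, ne_zero_of_re_pos hq], ?_⟩
    rw [← Complex.log_im, log_cpow_of_re_pos hα hq, Complex.im_mul_ofReal, Complex.log_im, abs_mul,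
      abs_of_pos hα0]
    have := Complex.abs_arg_lt_pi_div_two_iff.2 (Or.inl hq)
    nlinarith
  · rintro ⟨h0, harg⟩
    set v : ℂ := 2 * α * w + 1 with hv
    set q := Complex.exp (Complex.log v / α) with hq
    have him : (Complex.log v / α).im = v.arg / α := by
      rw [Complex.div_ofReal_im, Complex.log_im]
    have habs : |v.arg / α| < Real.pi / 2 := by
      rw [abs_div, abs_of_pos hα0, div_lt_iff₀ hα0]
      linarith
    have hqre : 0 < q.re := by
      rw [hq, Complex.exp_re, him]
      exact mul_pos (Real.exp_pos _) (Real.cos_pos_of_mem_Ioo (abs_lt.1 habs))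
    have hlog : Complex.log q = Complex.log v / α := by
      rw [hq, Complex.log_exp]
      · rw [him]; linarith [(abs_lt.1 habs).1]
      · rw [him]; linarith [(abs_lt.1 habs).2]
    have hqv : q ^ (α : ℂ) = v := by
      rw [Complex.cpow_def_of_ne_zero (ne_zero_of_re_pos hqre), hlog, div_mul_cancel₀ _ hαc,
        Complex.exp_log h0]
    have hq1 : q + 1 ≠ 0 := ne_zero_of_re_pos (by rw [Complex.add_re, Complex.one_re]; linarith)
    refine ⟨(q - 1) / (q + 1), ?_, ?_⟩
    · have h2 : 0 < ‖q + 1‖ := norm_pos_iff.2 hq1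
      rw [mem_ball_zero_iff, norm_div, div_lt_one h2]
      refine lt_of_pow_lt_pow_left₀ 2 h2.le ?_
      simp only [Complex.sq_norm, Complex.normSq_apply, Complex.add_re, Complex.add_im,
        Complex.sub_re, Complex.sub_im, Complex.one_re, Complex.one_im]
      nlinarith
    · have e : (1 + (q - 1) / (q + 1)) / (1 - (q - 1) / (q + 1)) = q := by
        have e1 : 1 + (q - 1) / (q + 1) = 2 * q / (q + 1) := by field_simp; ring
        have e2 : 1 - (q - 1) / (q + 1) = 2 / (q + 1) := by field_simp; ring
        rw [e1, e2, div_div_div_cancel_right₀ hq1, mul_div_cancel_left₀ _ two_ne_zero]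
      rw [gZero, e, hqv, hv]
      field_simp
      ring

lemma hasDerivAt_one_add_div_one_sub {z : ℂ} (hz : z ∈ ball (0 : ℂ) 1) :
    HasDerivAt (fun z : ℂ ↦ (1 + z) / (1 - z)) (2 / (1 - z) ^ 2) z := by
  have : HasDerivAt (fun z : ℂ ↦ (1 + z) / (1 - z))
      ((1 * (1 - z) - (1 + z) * (-1)) / (1 - z) ^ 2) z :=
    ((hasDerivAt_id z).const_add 1).div ((hasDerivAt_id z).const_sub 1)
      (one_sub_ne_zero_of_mem_ball hz)
  convert this using 1
  ring

lemma hasDerivAt_gZero (hα : 0 < α) {z : ℂ} (hz : z ∈ ball (0 : ℂ) 1) :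
    HasDerivAt (gZero α) (((1 + z) / (1 - z)) ^ ((α : ℂ) - 1) / (1 - z) ^ 2) z := by
  have hαc : (α : ℂ) ≠ 0 := by exact_mod_cast hα.ne'
  have h1 := one_sub_ne_zero_of_mem_ball hz
  have := (((hasDerivAt_one_add_div_one_sub hz).cpow_const (c := (α : ℂ))
    (Or.inl (one_add_div_one_sub_re_pos hz))).sub_const 1).const_mul (1 / (2 * (α : ℂ)))
  refine HasDerivAt.congr_deriv (f := gZero α) this ?_
  field_simp

lemma preSchwarzian_gZero (hα : 0 < α) {z : ℂ} (hz : z ∈ ball (0 : ℂ) 1) :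
    preSchwarzian (gZero α) z = (2 * (α - 1) / (1 + z) + 2) / (1 - z) := by
  have h1 := one_sub_ne_zero_of_mem_ball hz
  have hq := one_add_div_one_sub_re_pos hz
  have hq0 := ne_zero_of_re_pos hq
  have h2 : 1 + z ≠ 0 := fun h ↦ hq0 (by rw [h, zero_div])
  have hev : deriv (gZero α) =ᶠ[𝓝 z]
      fun z ↦ ((1 + z) / (1 - z)) ^ ((α : ℂ) - 1) / (1 - z) ^ 2 := by
    filter_upwards [isOpen_ball.mem_nhds hz] with w hw using (hasDerivAt_gZero hα hw).deriv
  have hd : HasDerivAt (fun z : ℂ ↦ (1 - z) ^ 2) (2 * (1 - z) * (-1)) z := by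
    have := ((hasDerivAt_id z).const_sub 1).pow 2
    simpa [Pi.pow_def] using this
  have hd2 : HasDerivAt (fun z ↦ ((1 + z) / (1 - z)) ^ ((α : ℂ) - 1) / (1 - z) ^ 2) _ z :=
    ((hasDerivAt_one_add_div_one_sub hz).cpow_const (c := (α : ℂ) - 1)
      (Or.inl hq)).div hd (pow_ne_zero 2 h1)
  rw [preSchwarzian, hev.deriv_eq, hev.eq_of_nhds, hd2.deriv,
    Complex.cpow_sub ((α : ℂ) - 1) 1 hq0, Complex.cpow_one]
  have hA : ((1 + z) / (1 - z)) ^ ((α : ℂ) - 1) ≠ 0 := by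
    simp [Complex.cpow_eq_zero_iff, h1, h2]
  set A := ((1 + z) / (1 - z)) ^ ((α : ℂ) - 1)
  field_simp
  ring

theorem isConcaveUnivalent_gZero (hα : α ∈ Icc (1 : ℝ) 2) : IsConcaveUnivalent α (gZero α) where
  analytic z hz :=
    (hasDerivAt_gZero (by linarith [hα.1]) hz).differentiableAt.differentiableWithinAt
  map_zero := by simp [gZero]
  deriv_zero := by
    simpa using (hasDerivAt_gZero (α := α) (by linarith [hα.1]) (mem_ball_self one_pos)).deriv
  tendsto_infinity := by
    have hα0 : 0 < α := by linarith [hα.1]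
    rw [← tendsto_norm_atTop_iff_cobounded]
    have h1 : Tendsto (fun z : ℂ ↦ ‖(1 + z) / (1 - z)‖) (𝓝[ball 0 1] 1) atTop := by
      refine tendsto_atTop_mono' _ ?_
        (tendsto_atTop_add_const_right _ (-1) tendsto_norm_inv_one_sub)
      filter_upwards [self_mem_nhdsWithin] with z hz
      have h1 := one_sub_ne_zero_of_mem_ball hz
      have e : (1 + z) / (1 - z) = 2 * (1 - z)⁻¹ - 1 := by field_simp; ring
      have := norm_sub_norm_le (2 * (1 - z)⁻¹) (1 : ℂ)
      rw [norm_one, norm_mul, Complex.norm_ofNat] at this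
      rw [e]
      linarith [norm_nonneg (1 - z)⁻¹]
    have h2 : Tendsto (fun z : ℂ ↦ 1 / (2 * α) * (‖(1 + z) / (1 - z)‖ ^ α + -1))
        (𝓝[ball 0 1] 1) atTop :=
      (tendsto_atTop_add_const_right _ _ ((tendsto_rpow_atTop hα0).comp h1)).const_mul_atTop
        (by positivity)
    refine tendsto_atTop_mono (fun z ↦ ?_) h2
    have h3 := norm_sub_norm_le (((1 + z) / (1 - z)) ^ (α : ℂ)) 1
    rw [norm_one, Complex.norm_cpow_real] at h3
    have h4 : ‖1 / (2 * (α : ℂ))‖ = 1 / (2 * α) := by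
      rw [norm_div, norm_one, norm_mul, Complex.norm_ofNat, Complex.norm_real, Real.norm_eq_abs,
        abs_of_pos hα0]
    rw [gZero, norm_mul, h4]
    gcongr
    linarith
  univalent := by
    intro z hz w hw h
    have hα0 : 0 < α := by linarith [hα.1]
    have hαc : (α : ℂ) ≠ 0 := by exact_mod_cast hα0.ne'
    have hqz := one_add_div_one_sub_re_pos hz
    have hqw := one_add_div_one_sub_re_pos hw
    have h1 : ((1 + z) / (1 - z)) ^ (α : ℂ) = ((1 + w) / (1 - w)) ^ (α : ℂ) := by
      rw [← two_mul_gZero_add_one hα0, ← two_mul_gZero_add_one hα0, h]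
    have h2 := congrArg Complex.log h1
    rw [log_cpow_of_re_pos hα hqz, log_cpow_of_re_pos hα hqw] at h2
    have h3 := congrArg Complex.exp (mul_right_cancel₀ hαc h2)
    rw [Complex.exp_log (ne_zero_of_re_pos hqz), Complex.exp_log (ne_zero_of_re_pos hqw),
      div_eq_div_iff (one_sub_ne_zero_of_mem_ball hz) (one_sub_ne_zero_of_mem_ball hw)] at h3
    linear_combination h3 / 2
  convex_compl := by
    intro x hx y hy a b ha hb hab
    rw [mem_compl_iff, mem_gZero_image_iff hα, ← exists_re_pos_iff_abs_arg_lt hα] at hx hy ⊢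
    -- Lying outside the image now means Re ≤ 0 for every admissible ψ: a family of conditions
    -- affine in the point, each preserved by convex combinations.
    push Not at hx hy ⊢
    intro ψ hψ
    have e : conj (Complex.exp (ψ * Complex.I)) * (2 * α * (a • x + b • y) + 1) =
        (a : ℂ) * (conj (Complex.exp (ψ * Complex.I)) * (2 * α * x + 1)) +
        (b : ℂ) * (conj (Complex.exp (ψ * Complex.I)) * (2 * α * y + 1)) := by
      have : (a : ℂ) + b = 1 := by exact_mod_cast hab
      rw [Complex.real_smul, Complex.real_smul]
      linear_combination (-conj (Complex.exp (ψ * Complex.I))) * this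
    rw [e, Complex.add_re, Complex.re_ofReal_mul, Complex.re_ofReal_mul]
    nlinarith [hx ψ hψ, hy ψ hψ]
  openingAngle_le := by
    have hα0 : 0 < α := by linarith [hα.1]
    have hsub : {θ : ℝ | θ ∈ Ioc (-Real.pi) Real.pi ∧
        ∀ᶠ t : ℝ in atTop, (t : ℂ) * Complex.exp (θ * Complex.I) ∈ gZero α '' ball 0 1} ⊆
        -- The direction π is set aside as a null set because the limit below needs continuity of
        -- `arg`, which fails on the negative axis.
        Icc (-(Real.pi * α / 2)) (Real.pi * α / 2) ∪ {Real.pi} := by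
      rintro θ ⟨hθ, ht⟩
      rcases hθ.2.eq_or_lt with heq | hlt
      · exact Or.inr heq
      left
      have hargE : (Complex.exp (θ * Complex.I)).arg = θ := by
        rwa [Complex.arg_exp_mul_I, toIocMod_eq_self,
          show -Real.pi + 2 * Real.pi = Real.pi by ring]
      set E : ℂ := 2 * α * Complex.exp (θ * Complex.I) with hE
      have hE2 : E = ((2 * α : ℝ) : ℂ) * Complex.exp (θ * Complex.I) := by rw [hE]; push_cast; ring
      have hEarg : E.arg = θ := by
        rw [hE2, Complex.arg_real_mul _ (by positivity), hargE]
      have hEs : E ∈ Complex.slitPlane := by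
        rw [Complex.mem_slitPlane_iff_arg, hEarg]
        refine ⟨hlt.ne, ?_⟩
        rw [hE2]
        exact mul_ne_zero (by exact_mod_cast (by positivity : (2 * α : ℝ) ≠ 0))
          (Complex.exp_ne_zero _)
      -- A point of the ray, mapped by w ↦ 2αw + 1, is t(E + 1/t); the positive factor t does not
      -- affect the argument, which tends to θ.
      have hlim : Tendsto (fun t : ℝ ↦ E + ((t⁻¹ : ℝ) : ℂ)) atTop (𝓝 (E + ((0 : ℝ) : ℂ))) :=
        ((Complex.continuous_ofReal.tendsto 0).comp tendsto_inv_atTop_zero).const_add E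
      rw [Complex.ofReal_zero, add_zero] at hlim
      have hlim2 := ((Complex.continuousAt_arg hEs).tendsto.comp hlim).abs
      rw [hEarg] at hlim2
      rw [mem_Icc, ← abs_le]
      refine le_of_tendsto hlim2 ?_
      filter_upwards [ht, eventually_gt_atTop 0] with t ht ht0
      have h1 := ((mem_gZero_image_iff hα).1 ht).2
      have e : 2 * α * ((t : ℂ) * Complex.exp (θ * Complex.I)) + 1 =
          (t : ℂ) * (E + ((t⁻¹ : ℝ) : ℂ)) := by
        have : (t : ℂ) ≠ 0 := by exact_mod_cast ht0.ne'
        rw [hE]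
        push_cast
        field_simp
      rw [e, Complex.arg_real_mul _ ht0] at h1
      exact h1.le
    calc _ ≤ volume (Icc (-(Real.pi * α / 2)) (Real.pi * α / 2)) + volume {Real.pi} :=
          (measure_mono hsub).trans (measure_union_le _ _)
      _ = _ := by
        rw [Real.volume_Icc, Real.volume_singleton, add_zero]
        congr 1
        ring

/-- At real x in (0, 1) the weighted quantity equals 2(α - 1) + 2(1 + x) = 2α + 2x, which tends to
2α + 2 as x → 1. -/
theorem le_preSchwarzianNorm_gZero (hα : 1 ≤ α) :
    ENNReal.ofReal (2 * α + 2) ≤ preSchwarzianNorm (gZero α) := by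
  have hlim : Tendsto (fun x : ℝ ↦ ENNReal.ofReal (2 * α + 2 * x)) (𝓝[<] 1)
      (𝓝 (ENNReal.ofReal (2 * α + 2 * 1))) :=
    ENNReal.tendsto_ofReal (((tendsto_id.mono_left nhdsWithin_le_nhds).const_mul 2).const_add _)
  rw [mul_one] at hlim
  refine le_of_tendsto hlim ?_
  filter_upwards [Ioo_mem_nhdsLT (zero_lt_one' ℝ)] with x hx
  have hxn : ‖(x : ℂ)‖ = x := by rw [Complex.norm_real, Real.norm_eq_abs, abs_of_pos hx.1]
  have hxb : (x : ℂ) ∈ ball (0 : ℂ) 1 := by rw [mem_ball_zero_iff, hxn]; exact hx.2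
  have hx1 : 0 < 1 - x := by linarith [hx.2]
  have hx2 : 0 < 1 + x := by linarith [hx.1]
  have e : preSchwarzian (gZero α) x = (((2 * (α - 1) / (1 + x) + 2) / (1 - x) : ℝ) : ℂ) := by
    rw [preSchwarzian_gZero (by linarith) hxb]
    push_cast
    ring
  have h0 : 0 ≤ (2 * (α - 1) / (1 + x) + 2) / (1 - x) := by
    have : 0 ≤ α - 1 := by linarith
    positivity
  have h1 : 2 * α + 2 * x = (1 - ‖(x : ℂ)‖ ^ 2) * ‖preSchwarzian (gZero α) x‖ := by
    rw [e, hxn, Complex.norm_real, Real.norm_eq_abs, abs_of_nonneg h0]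
    field_simp
    ring
  rw [h1]
  exact le_iSup₂ (f := fun z (_ : z ∈ ball (0 : ℂ) 1) ↦
    ENNReal.ofReal ((1 - ‖z‖ ^ 2) * ‖preSchwarzian (gZero α) z‖)) (x : ℂ) hxb

end SectorMap

/-! ### The main theorem -/

theorem mainTheorem2 (α : ℝ) (hα : α ∈ Set.Icc (1 : ℝ) 2) :
    (∀ f : ℂ → ℂ, IsConcaveUnivalent α f →
      4 ≤ preSchwarzianNorm f ∧ preSchwarzianNorm f ≤ ENNReal.ofReal (2 * α + 2)) ∧
    (IsConcaveUnivalent α gPi ∧ preSchwarzianNorm gPi = 4) ∧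
    (IsConcaveUnivalent α (gZero α) ∧
      preSchwarzianNorm (gZero α) = ENNReal.ofReal (2 * α + 2)) := by
  refine ⟨fun f hf ↦ ⟨hf.four_le_preSchwarzianNorm, hf.preSchwarzianNorm_le hα.1⟩,
    ⟨isConcaveUnivalent_gPi.mono hα.1, ?_⟩, isConcaveUnivalent_gZero hα, ?_⟩
  · refine le_antisymm ?_ isConcaveUnivalent_gPi.four_le_preSchwarzianNorm
    refine (isConcaveUnivalent_gPi.preSchwarzianNorm_le le_rfl).trans_eq ?_
    rw [show (2 * 1 + 2 : ℝ) = 4 by norm_num]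
    exact ENNReal.ofReal_ofNat 4
  · exact le_antisymm ((isConcaveUnivalent_gZero hα).preSchwarzianNorm_le hα.1)
      (le_preSchwarzianNorm_gZero hα.1)
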